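/- Let $r,\lambda,\mu>0$ and $\zeta^+,\zeta^-\in\mathbb{R}$, let $\mathsf h=\ell^2(\mathbb N)$ with canonical orthonormal basis $(e_n)_{n\ge0}$ and number operator $Ne_n=ne_n$, and put $\omega_n=n(n+r-1)$. Let $B,B^+$ be the operators with domain $\mathrm{Dom}(N)$ given by $Be_0=0$, $Be_n=\omega_n^{1/2}e_{n-1}$ for $n\ge1$, and $B^+e_n=\omega_{n+1}^{1/2}e_{n+1}$. Let $L_1=\mu B$, $L_2=\lambda B^+$, and on $\mathrm{Dom}(G)=\mathrm{Dom}(N^2)$ let $$G=-\tfrac{\lambda^2}{2}BB^+-\tfrac{\mu^2}{2}B^+B-i\left(\zeta^+BB^++\zeta^-B^+B\right),$$ which generates the contraction semigroup $$P_te_n=\exp\left(-t\left[\left(\tfrac{\lambda^2}{2}+i\zeta^+\right)\omega_{n+1}+\left(\tfrac{\mu^2}{2}+i\zeta^-\right)\omega_n\right]\right)e_n,\qquad t\ge0.$$ Let $(\mathcal T_t)_{t\ge0}$ be the minimal quantum dynamical semigroup on $\mathcal B(\mathsf h)$ associated with $G,L_1,L_2$, that is, $\mathcal T_t(x)=\lim_{n\to\infty}\mathcal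 T^{(n)}_t(x)$ in the weak operator topology (an increasing limit when $x\ge0$), where $\mathcal T^{(0)}_t(x)=P_t^*xP_t$ and, for all $u,v\in\mathrm{Dom}(G)$, $$\langle v,\mathcal T^{(n+1)}_t(x)u\rangle=\langle P_tv,xP_tu\rangle+\sum_{\ell=1}^2\int_0^t\langle L_\ell P_{t-s}v,\mathcal T^{(n)}_s(x)L_\ell P_{t-s}u\rangle\,ds.$$ If $\nu=\lambda/\mu<1$, then $$\rho=(1-\nu^2)\sum_{n\ge0}\nu^{2n}|e_n\rangle\langle e_n|$$ is a normal state (a positive operator with trace $1$) and it is invariant: $\mathrm{tr}(\rho\,\mathcal T_t(x))=\mathrm{tr}(\rho x)$ for all $t\ge0$ and all $x\in\mathcal B(\mathsf h)$. -/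

import Mathlib

open Filter Topology
open scoped InnerProductSpace lp

noncomputable section

/-! ### The minimal quantum dynamical semigroup of operators `G`, `L ℓ` on a Hilbert space

`P` is the contraction semigroup generated by `G`. -/

namespace MinimalQDS

variable {H : Type*} [NormedAddCommGroup H] [InnerProductSpace ℂ H] [CompleteSpace H]

/-- The value `L u` of an unbounded operator, set to `0` when `u` is outside its domain. -/
def applyOrZero (L : H →ₗ.[ℂ] H) (u : H) : H :=
  open Classical in if hu : u ∈ L.domain then L ⟨u, hu⟩ else 0

/-- The bounded operator `A` with `⟪v, A u⟫ = q v u` for all `u, v` in the subspace `D`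
(it is unique when `D` is dense), and `0` if there is none. -/
def ofForm (D : Submodule ℂ H) (q : H → H → ℂ) : H →L[ℂ] H :=
  open Classical in
  if hq : ∃ A : H →L[ℂ] H, ∀ v ∈ D, ∀ u ∈ D, ⟪v, A u⟫_ℂ = q v u then hq.choose else 0

/-- The limit in the weak operator topology of a sequence of bounded operators,
and `0` if there is none. -/
def weakLimit (A : ℕ → H →L[ℂ] H) : H →L[ℂ] H :=
  open Classical in
  if hA : ∃ B : H →L[ℂ] H,
    ∀ v u : H, Tendsto (fun n => ⟪v, A n u⟫_ℂ) atTop (𝓝 ⟪v, B u⟫_ℂ) then hA.choose else 0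

/-- The iterates `T⁽ⁿ⁾`: `T⁽⁰⁾_t(x) = P_t* x P_t`, and for `u, v ∈ Dom(G)`
`⟨v, T⁽ⁿ⁺¹⁾_t(x) u⟩ = ⟨v, P_t* x P_t u⟩
  + ∑_ℓ ∫_0^t ⟨L_ℓ P_{t-s} v, T⁽ⁿ⁾_s(x) L_ℓ P_{t-s} u⟩ ds`. -/
def iterate {ι : Type*} [Fintype ι] (G : H →ₗ.[ℂ] H) (P : ℝ → H →L[ℂ] H)
    (L : ι → H →ₗ.[ℂ] H) : ℕ → ℝ → (H →L[ℂ] H) → (H →L[ℂ] H)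
  | 0, t, x => (ContinuousLinearMap.adjoint (P t)) ∘L x ∘L P t
  | n + 1, t, x => ofForm G.domain fun v u =>
      ⟪P t v, x (P t u)⟫_ℂ + ∑ ℓ : ι, ∫ s in (0 : ℝ)..t,
        ⟪applyOrZero (L ℓ) (P (t - s) v),
          iterate G P L n s x (applyOrZero (L ℓ) (P (t - s) u))⟫_ℂ

/-- The minimal quantum dynamical semigroup `T_t(x)`, `t ≥ 0`: the limit of the iterates
(for `x ≥ 0` they increase and `T_t(x)` is their supremum). -/
def minimalSemigroup {ι : Type*} [Fintype ι] (G : H →ₗ.[ℂ] H) (P : ℝ → H →L[ℂ] H)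
    (L : ι → H →ₗ.[ℂ] H) (t : ℝ) (x : H →L[ℂ] H) : H →L[ℂ] H :=
  weakLimit fun n => iterate G P L n t x

end MinimalQDS

/-! ### The quadratic open quantum harmonic oscillator -/

namespace QuadraticOscillator

/-- The Hilbert space `ℓ²(ℕ)`. -/
abbrev Fock : Type := ℓ²(ℕ, ℂ)

/-- The canonical orthonormal basis. -/
def e (n : ℕ) : Fock := lp.single 2 n (1 : ℂ)

/-- `ω_n = n (n + r - 1)`. -/
def omega (r : ℝ) (n : ℕ) : ℝ := n * (n + r - 1)

lemma abs_omega_le (r : ℝ) (n : ℕ) : |omega r n| ≤ (1 + |r - 1|) * (n : ℝ) ^ 2 := by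
  have hn : (n : ℝ) ≤ (n : ℝ) ^ 2 := by exact_mod_cast Nat.le_self_pow two_ne_zero n
  have h0 : (0 : ℝ) ≤ n := n.cast_nonneg
  have h1 := neg_abs_le (r - 1)
  have h2 := le_abs_self (r - 1)
  have h3 := abs_nonneg (r - 1)
  unfold omega
  rw [abs_le]
  constructor <;> nlinarith

lemma sqrt_omega_sq_le (r : ℝ) (n : ℕ) :
    Real.sqrt (omega r n) ^ 2 ≤ (1 + |r - 1|) * (n : ℝ) ^ 2 := by
  rcases le_total 0 (omega r n) with h | h
  · rw [Real.sq_sqrt h]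
    exact (le_abs_self _).trans (abs_omega_le r n)
  · rw [Real.sqrt_eq_zero_of_nonpos h, zero_pow two_ne_zero]
    positivity

lemma memℓp_two_iff {f : ℕ → ℂ} : Memℓp f 2 ↔ Summable fun n => ‖f n‖ ^ 2 := by
  rw [memℓp_gen_iff (by norm_num)]
  norm_num

lemma summable_sq (u : Fock) : Summable fun n => ‖u n‖ ^ 2 := memℓp_two_iff.1 (lp.memℓp u)

/-- The domain of the power `N ^ k` of the number operator `N e_n = n e_n`. -/
def domN (k : ℕ) : Submodule ℂ Fock where
  carrier := {u | Summable fun n : ℕ => ((n : ℝ) ^ k) ^ 2 * ‖u n‖ ^ 2}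
  zero_mem' := by simp
  add_mem' := by
    intro u v hu hv
    refine Summable.of_nonneg_of_le (fun n => by positivity) (fun n => ?_)
      ((hu.mul_left 2).add (hv.mul_left 2))
    have h1 : ‖(u + v : Fock) n‖ ≤ ‖u n‖ + ‖v n‖ := norm_add_le _ _
    have h2 : ‖(u + v : Fock) n‖ ^ 2 ≤ 2 * ‖u n‖ ^ 2 + 2 * ‖v n‖ ^ 2 := by
      nlinarith [norm_nonneg ((u + v : Fock) n), sq_nonneg (‖u n‖ - ‖v n‖)]
    nlinarith [mul_le_mul_of_nonneg_left h2 (sq_nonneg ((n : ℝ) ^ k))]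
  smul_mem' := by
    intro c u hu
    refine (hu.mul_left (‖c‖ ^ 2)).congr fun n => ?_
    have : ‖(c • u : Fock) n‖ = ‖c‖ * ‖u n‖ := norm_mul c (u n)
    rw [this]
    ring

lemma summable_shift {k : ℕ} {u : Fock} (hu : u ∈ domN k) :
    Summable fun n : ℕ => (((n + 1 : ℕ) : ℝ) ^ k) ^ 2 * ‖u n‖ ^ 2 := by
  have hu' : Summable fun n : ℕ => ((n : ℝ) ^ k) ^ 2 * ‖u n‖ ^ 2 := hu
  refine Summable.of_nonneg_of_le (fun n => by positivity) (fun n => ?_)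
    ((hu'.mul_left ((2 ^ k) ^ 2)).add (summable_sq u))
  rcases Nat.eq_zero_or_pos n with rfl | hn
  · rcases Nat.eq_zero_or_pos k with rfl | hk
    · simp
    · simp [hk.ne']
  · have h1 : (1 : ℝ) ≤ n := by exact_mod_cast hn
    have h2 : (((n + 1 : ℕ) : ℝ) ^ k) ^ 2 ≤ ((2 * (n : ℝ)) ^ k) ^ 2 := by
      gcongr
      push_cast
      linarith
    have h3 := mul_le_mul_of_nonneg_right h2 (sq_nonneg ‖u n‖)
    rw [mul_pow, mul_pow] at h3
    nlinarith [sq_nonneg ‖u n‖]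

lemma domN_two_le_one : domN 2 ≤ domN 1 := by
  intro u hu
  have hu' : Summable fun n : ℕ => ((n : ℝ) ^ 2) ^ 2 * ‖u n‖ ^ 2 := hu
  refine Summable.of_nonneg_of_le (fun n => by positivity) (fun n => ?_) hu'
  have hn : (n : ℝ) ^ 1 ≤ (n : ℝ) ^ 2 := by
    rw [pow_one]
    exact_mod_cast Nat.le_self_pow two_ne_zero n
  gcongr

/-- Coordinates of `B u`. -/
def annihilationSeq (r : ℝ) (u : ℕ → ℂ) (n : ℕ) : ℂ := (Real.sqrt (omega r (n + 1)) : ℂ) * u (n + 1)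

/-- Coordinates of `B⁺ u`. -/
def creationSeq (r : ℝ) (u : ℕ → ℂ) : ℕ → ℂ
  | 0 => 0
  | n + 1 => (Real.sqrt (omega r (n + 1)) : ℂ) * u n

lemma annihilationSeq_summable (r : ℝ) (k : ℕ) {u : Fock} (hu : u ∈ domN (k + 1)) :
    Summable fun n : ℕ => ((n : ℝ) ^ k) ^ 2 * ‖annihilationSeq r u n‖ ^ 2 := by
  have hu' : Summable fun n : ℕ => ((n : ℝ) ^ (k + 1)) ^ 2 * ‖u n‖ ^ 2 := hu
  refine Summable.of_nonneg_of_le (fun n => by positivity) (fun n => ?_)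
    (((summable_nat_add_iff 1).2 hu').mul_left (1 + |r - 1|))
  have h1 := sqrt_omega_sq_le r (n + 1)
  have h2 : ((n : ℝ) ^ k) ^ 2 ≤ (((n + 1 : ℕ) : ℝ) ^ k) ^ 2 := by
    gcongr
    simp
  rw [annihilationSeq, norm_mul, mul_pow, Complex.norm_real, Real.norm_eq_abs, sq_abs]
  calc _ ≤ (((n + 1 : ℕ) : ℝ) ^ k) ^ 2 *
        ((1 + |r - 1|) * ((n + 1 : ℕ) : ℝ) ^ 2 * ‖u (n + 1)‖ ^ 2) := by gcongr
    _ = _ := by ring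

lemma creationSeq_summable (r : ℝ) (k : ℕ) {u : Fock} (hu : u ∈ domN (k + 1)) :
    Summable fun n : ℕ => ((n : ℝ) ^ k) ^ 2 * ‖creationSeq r u n‖ ^ 2 := by
  rw [← summable_nat_add_iff 1]
  refine Summable.of_nonneg_of_le (fun n => by positivity) (fun n => ?_)
    ((summable_shift hu).mul_left (1 + |r - 1|))
  have h1 := sqrt_omega_sq_le r (n + 1)
  rw [creationSeq, norm_mul, mul_pow, Complex.norm_real, Real.norm_eq_abs, sq_abs]
  calc _ ≤ (((n + 1 : ℕ) : ℝ) ^ k) ^ 2 *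
        ((1 + |r - 1|) * ((n + 1 : ℕ) : ℝ) ^ 2 * ‖u n‖ ^ 2) := by gcongr
    _ = _ := by ring

/-- The annihilation operator: `B e_0 = 0`, `B e_n = ω_n^{1/2} e_{n-1}`, with domain `Dom(N)`. -/
def B (r : ℝ) : Fock →ₗ.[ℂ] Fock where
  domain := domN 1
  toFun :=
    { toFun := fun u => ⟨annihilationSeq r (u : Fock), memℓp_two_iff.2 (by
        simpa using annihilationSeq_summable r 0 u.2)⟩
      map_add' := fun u v => by
        ext n
        exact mul_add _ _ _
      map_smul' := fun c u => by
        ext n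
        exact mul_left_comm _ _ _ }

/-- The creation operator: `B⁺ e_n = ω_{n+1}^{1/2} e_{n+1}`, with domain `Dom(N)`. -/
def Bplus (r : ℝ) : Fock →ₗ.[ℂ] Fock where
  domain := domN 1
  toFun :=
    { toFun := fun u => ⟨creationSeq r (u : Fock), memℓp_two_iff.2 (by
        simpa using creationSeq_summable r 0 u.2)⟩
      map_add' := fun u v => by
        ext n
        cases n with
        | zero => exact (add_zero (0 : ℂ)).symm
        | succ n => exact mul_add _ _ _
      map_smul' := fun c u => by
        ext n
        cases n with
        | zero => exact (mul_zero c).symm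
        | succ n => exact mul_left_comm _ _ _ }

/-- `B` as a map `Dom(N²) → Dom(N)`. -/
def B₂ (r : ℝ) : domN 2 →ₗ[ℂ] domN 1 :=
  ((B r).toFun ∘ₗ Submodule.inclusion domN_two_le_one).codRestrict (domN 1)
    fun u => annihilationSeq_summable r 1 u.2

/-- `B⁺` as a map `Dom(N²) → Dom(N)`. -/
def Bplus₂ (r : ℝ) : domN 2 →ₗ[ℂ] domN 1 :=
  ((Bplus r).toFun ∘ₗ Submodule.inclusion domN_two_le_one).codRestrict (domN 1)
    fun u => creationSeq_summable r 1 u.2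

/-- `G = -(λ²/2) B B⁺ - (μ²/2) B⁺ B - i (ζ⁺ B B⁺ + ζ⁻ B⁺ B)` with domain `Dom(N²)`. -/
def G (r lam mu ζp ζm : ℝ) : Fock →ₗ.[ℂ] Fock where
  domain := domN 2
  toFun :=
    -((lam : ℂ) ^ 2 / 2) • ((B r).toFun ∘ₗ Bplus₂ r)
      - ((mu : ℂ) ^ 2 / 2) • ((Bplus r).toFun ∘ₗ B₂ r)
      - Complex.I • ((ζp : ℂ) • ((B r).toFun ∘ₗ Bplus₂ r)
        + (ζm : ℂ) • ((Bplus r).toFun ∘ₗ B₂ r))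

/-- `L₁ = μ B`, `L₂ = λ B⁺`. -/
def L (r lam mu : ℝ) : Fin 2 → Fock →ₗ.[ℂ] Fock :=
  ![(mu : ℂ) • B r, (lam : ℂ) • Bplus r]

lemma mul_memℓp {c : ℕ → ℂ} {C : ℝ} (hc : ∀ n, ‖c n‖ ≤ C) (u : Fock) :
    Memℓp (fun n => c n * u n) 2 := by
  rw [memℓp_two_iff]
  refine Summable.of_nonneg_of_le (fun n => by positivity) (fun n => ?_)
    ((summable_sq u).mul_left (C ^ 2))
  rw [norm_mul, mul_pow]
  have := hc n
  gcongr

/-- The diagonal operator `e_n ↦ c_n e_n` for a bounded sequence `c` (`0` if `c` is unbounded). -/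
def diagonal (c : ℕ → ℂ) : Fock →L[ℂ] Fock :=
  open Classical in
  if hc : ∃ C, ∀ n, ‖c n‖ ≤ C then
    LinearMap.mkContinuous
      { toFun := fun u => ⟨fun n => c n * u n, mul_memℓp hc.choose_spec u⟩
        map_add' := fun u v => by
          ext n
          exact mul_add _ _ _
        map_smul' := fun a u => by
          ext n
          exact mul_left_comm _ _ _ } hc.choose (fun u => by
        have hC : 0 ≤ hc.choose := (norm_nonneg _).trans (hc.choose_spec 0)
        refine lp.norm_le_of_tsum_le (by norm_num) (by positivity) ?_
        have h1 := lp.norm_rpow_eq_tsum (p := 2) (by norm_num) u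
        rw [Real.mul_rpow hC (norm_nonneg _), h1, ← tsum_mul_left]
        norm_num
        refine Summable.tsum_le_tsum (fun n => ?_)
          (memℓp_two_iff.1 (mul_memℓp hc.choose_spec u) |>.congr fun n => by
            rw [norm_mul]) ((summable_sq u).mul_left _)
        rw [mul_pow]
        have := hc.choose_spec n
        gcongr)
  else 0

/-- The decay rates: `G e_n = -γ_n e_n` with
`γ_n = (λ²/2 + i ζ⁺) ω_{n+1} + (μ²/2 + i ζ⁻) ω_n`. -/
def rate (r lam mu ζp ζm : ℝ) (n : ℕ) : ℂ :=
  ((lam : ℂ) ^ 2 / 2 + Complex.I * ζp) * (omega r (n + 1) : ℂ)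
    + ((mu : ℂ) ^ 2 / 2 + Complex.I * ζm) * (omega r n : ℂ)

/-- The contraction semigroup `P_t e_n = exp(-t γ_n) e_n`, `t ≥ 0`, generated by `G`. -/
def P (r lam mu ζp ζm t : ℝ) : Fock →L[ℂ] Fock :=
  diagonal fun n => Complex.exp (-(t : ℂ) * rate r lam mu ζp ζm n)

lemma rate_re_nonneg {r : ℝ} (hr : 0 < r) (lam mu ζp ζm : ℝ) (n : ℕ) :
    0 ≤ (rate r lam mu ζp ζm n).re := by
  have h : ∀ k : ℕ, 0 ≤ omega r k := fun k => by
    rcases Nat.eq_zero_or_pos k with rfl | hk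
    · simp [omega]
    · have : (1 : ℝ) ≤ k := by exact_mod_cast hk
      exact mul_nonneg k.cast_nonneg (by linarith)
  have h1 := h n
  have h2 := h (n + 1)
  have : (rate r lam mu ζp ζm n).re
      = lam ^ 2 / 2 * omega r (n + 1) + mu ^ 2 / 2 * omega r n := by
    simp [rate, ← Complex.ofReal_pow]
  rw [this]
  positivity

lemma G_apply {r : ℝ} (hr : 0 < r) (lam mu ζp ζm : ℝ) (u : (G r lam mu ζp ζm).domain) (n : ℕ) :
    G r lam mu ζp ζm u n = -rate r lam mu ζp ζm n * (u : Fock) n := by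
  have h : ∀ k : ℕ, 0 ≤ omega r k := fun k => by
    rcases Nat.eq_zero_or_pos k with rfl | hk
    · simp [omega]
    · have : (1 : ℝ) ≤ k := by exact_mod_cast hk
      exact mul_nonneg k.cast_nonneg (by linarith)
  have hs : ∀ k : ℕ, (Real.sqrt (omega r k) : ℂ) * (Real.sqrt (omega r k) : ℂ) = omega r k :=
    fun k => by rw [← Complex.ofReal_mul, Real.mul_self_sqrt (h k)]
  have h1 : (((B r).toFun ∘ₗ Bplus₂ r) u : Fock) n = omega r (n + 1) * (u : Fock) n := by
    rw [← hs, mul_assoc]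
    rfl
  have h2 : (((Bplus r).toFun ∘ₗ B₂ r) u : Fock) n = omega r n * (u : Fock) n := by
    cases n with
    | zero =>
      have h0 : (omega r 0 : ℂ) = 0 := by simp [omega]
      rw [h0, zero_mul]
      rfl
    | succ n =>
      rw [← hs, mul_assoc]
      rfl
  have h3 : G r lam mu ζp ζm u n =
      -((lam : ℂ) ^ 2 / 2) * (((B r).toFun ∘ₗ Bplus₂ r) u : Fock) n
      - ((mu : ℂ) ^ 2 / 2) * (((Bplus r).toFun ∘ₗ B₂ r) u : Fock) n
      - Complex.I * ((ζp : ℂ) * (((B r).toFun ∘ₗ Bplus₂ r) u : Fock) n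
        + (ζm : ℂ) * (((Bplus r).toFun ∘ₗ B₂ r) u : Fock) n) := rfl
  rw [h3, h1, h2, rate]
  ring

lemma P_apply {r t : ℝ} (hr : 0 < r) (ht : 0 ≤ t) (lam mu ζp ζm : ℝ) (u : Fock) (n : ℕ) :
    P r lam mu ζp ζm t u n = Complex.exp (-(t : ℂ) * rate r lam mu ζp ζm n) * u n := by
  have hc : ∃ C, ∀ n, ‖Complex.exp (-(t : ℂ) * rate r lam mu ζp ζm n)‖ ≤ C := by
    refine ⟨1, fun n => ?_⟩
    rw [Complex.norm_exp, Real.exp_le_one_iff]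
    have := mul_nonneg ht (rate_re_nonneg hr lam mu ζp ζm n)
    simpa using this
  rw [P, diagonal, dif_pos hc]
  rfl

/-- `G` is the generator of `P` on `Dom(G)`: `(P_t u - u) / t → G u` in norm. -/
lemma P_generator {r : ℝ} (hr : 0 < r) (lam mu ζp ζm : ℝ) (u : (G r lam mu ζp ζm).domain) :
    Tendsto (fun t : ℝ => (t : ℂ)⁻¹ • (P r lam mu ζp ζm t u - (u : Fock)))
      (𝓝[>] 0) (𝓝 (G r lam mu ζp ζm u)) := by
  set γ := rate r lam mu ζp ζm with hγ
  rw [tendsto_iff_norm_sub_tendsto_zero]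
  have key : ∀ t : ℝ, 0 < t → ‖(t : ℂ)⁻¹ • (P r lam mu ζp ζm t u - (u : Fock))
      - G r lam mu ζp ζm u‖ ^ 2
      = ∑' n, ‖((t : ℂ)⁻¹ * (Complex.exp (-(t : ℂ) * γ n) - 1) + γ n) * (u : Fock) n‖ ^ 2 := by
    intro t ht
    have h1 := lp.norm_rpow_eq_tsum (p := 2) (by norm_num)
      ((t : ℂ)⁻¹ • (P r lam mu ζp ζm t u - (u : Fock)) - G r lam mu ζp ζm u)
    norm_num at h1
    rw [h1]
    refine tsum_congr fun n => ?_
    have h2 : ((t : ℂ)⁻¹ • (P r lam mu ζp ζm t u - (u : Fock)) - G r lam mu ζp ζm u : Fock) n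
        = (t : ℂ)⁻¹ * (P r lam mu ζp ζm t u n - (u : Fock) n) - G r lam mu ζp ζm u n := rfl
    have h3 : (t : ℂ)⁻¹ * (P r lam mu ζp ζm t u n - (u : Fock) n) - G r lam mu ζp ζm u n
        = ((t : ℂ)⁻¹ * (Complex.exp (-(t : ℂ) * γ n) - 1) + γ n) * (u : Fock) n := by
      rw [P_apply hr ht.le, G_apply hr]
      ring
    exact congrArg (fun z : ℂ => ‖z‖ ^ 2) (h2.trans h3)
  have lim : Tendsto (fun t : ℝ => ∑' n,
      ‖((t : ℂ)⁻¹ * (Complex.exp (-(t : ℂ) * γ n) - 1) + γ n) * (u : Fock) n‖ ^ 2)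
      (𝓝[>] 0) (𝓝 (∑' _n : ℕ, (0 : ℝ))) := by
    refine tendsto_tsum_of_dominated_convergence
      (bound := fun n => 9 * ‖G r lam mu ζp ζm u n‖ ^ 2) ((summable_sq _).mul_left 9) ?_ ?_
    · intro n
      have hd : HasDerivAt (fun t : ℝ => Complex.exp (-(t : ℂ) * γ n)) (-γ n) 0 := by
        have := (((Complex.ofRealCLM.hasDerivAt (x := 0)).neg.mul_const (γ n)).cexp)
        simpa using this
      have h1 := hd.tendsto_slope_zero_right
      have h2 : Tendsto (fun t : ℝ => ‖((t : ℂ)⁻¹ * (Complex.exp (-(t : ℂ) * γ n) - 1) + γ n)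
          * (u : Fock) n‖ ^ 2) (𝓝[>] 0) (𝓝 (‖(-γ n + γ n) * (u : Fock) n‖ ^ 2)) := by
        refine (((Tendsto.congr (fun t => ?_) h1).add_const (γ n)).mul_const _).norm.pow 2
        simp
      simpa using h2
    · filter_upwards [self_mem_nhdsWithin] with t ht n
      have ht' : 0 < t := ht
      rw [G_apply hr, Real.norm_of_nonneg (by positivity), norm_mul, norm_mul, norm_neg, mul_pow,
        mul_pow, ← mul_assoc]
      have hb : ‖Complex.exp (-(t : ℂ) * γ n) - 1‖ ≤ 2 * (t * ‖γ n‖) := by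
        have hn : ‖-(t : ℂ) * γ n‖ = t * ‖γ n‖ := by
          rw [norm_mul, norm_neg, Complex.norm_real, Real.norm_of_nonneg ht'.le]
        rcases le_total ‖-(t : ℂ) * γ n‖ 1 with h | h
        · rw [← hn]
          exact Complex.norm_exp_sub_one_le h
        · rw [← hn]
          have h1 : ‖Complex.exp (-(t : ℂ) * γ n)‖ ≤ 1 := by
            rw [Complex.norm_exp, Real.exp_le_one_iff]
            have := mul_nonneg ht'.le (rate_re_nonneg hr lam mu ζp ζm n)
            simpa using this
          have h2 := norm_sub_le (Complex.exp (-(t : ℂ) * γ n)) 1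
          rw [norm_one] at h2
          linarith
      have hb2 : ‖(t : ℂ)⁻¹ * (Complex.exp (-(t : ℂ) * γ n) - 1) + γ n‖ ≤ 3 * ‖γ n‖ := by
        refine (norm_add_le _ _).trans ?_
        rw [norm_mul, norm_inv, Complex.norm_real, Real.norm_of_nonneg ht'.le]
        have := mul_le_mul_of_nonneg_left hb (inv_nonneg.2 ht'.le)
        have e1 : t⁻¹ * (2 * (t * ‖γ n‖)) = 2 * ‖γ n‖ := by field_simp
        linarith
      have hb3 := pow_le_pow_left₀ (norm_nonneg _) hb2 2
      rw [mul_pow, show (3 : ℝ) ^ 2 = 9 by norm_num] at hb3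
      exact mul_le_mul_of_nonneg_right hb3 (sq_nonneg _)
  rw [tsum_zero] at lim
  have lim2 : Tendsto (fun t : ℝ => ‖(t : ℂ)⁻¹ • (P r lam mu ζp ζm t u - (u : Fock))
      - G r lam mu ζp ζm u‖ ^ 2) (𝓝[>] 0) (𝓝 0) := by
    refine lim.congr' ?_
    filter_upwards [self_mem_nhdsWithin] with t ht
    exact (key t ht).symm
  simpa using lim2.sqrt

/-- The minimal semigroup of the quadratic open quantum harmonic oscillator. -/
def semigroup (r lam mu ζp ζm : ℝ) (t : ℝ) (x : Fock →L[ℂ] Fock) : Fock →L[ℂ] Fock :=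
  MinimalQDS.minimalSemigroup (G r lam mu ζp ζm) (P r lam mu ζp ζm) (L r lam mu) t x

/-- The trace, computed in the canonical basis. -/
def trace (A : Fock →L[ℂ] Fock) : ℂ := ∑' n, ⟪e n, A (e n)⟫_ℂ

/-- Density operators (normal states): positive operators with trace one. -/
def IsDensityOperator (ρ : Fock →L[ℂ] Fock) : Prop :=
  ρ.IsPositive ∧ HasSum (fun n => ⟪e n, ρ (e n)⟫_ℂ) 1

/-- The normal state `x ↦ tr(ρ x)` is invariant under `(T_t)_{t ≥ 0}`:
`tr(ρ T_t(x)) = tr(ρ x)` for every bounded `x` and `t ≥ 0`. -/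
def IsInvariantState (T : ℝ → (Fock →L[ℂ] Fock) → (Fock →L[ℂ] Fock))
    (ρ : Fock →L[ℂ] Fock) : Prop :=
  IsDensityOperator ρ ∧
    ∀ t : ℝ, 0 ≤ t → ∀ x : Fock →L[ℂ] Fock, trace (ρ ∘L T t x) = trace (ρ ∘L x)

/-- `ρ = (1 - ν²) ∑_n ν^{2n} |e_n⟩⟨e_n|`, the series converging in operator norm for `|ν| < 1`. -/
def geometricState (ν : ℝ) : Fock →L[ℂ] Fock :=
  (1 - (ν : ℂ) ^ 2) • ∑' n : ℕ, (ν : ℂ) ^ (2 * n) • InnerProductSpace.rankOne ℂ (e n) (e n)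

end QuadraticOscillator

end

/-! Pairing with `ρ` only sees the diagonal entries `m_j(t) = ⟨e_j, T_t(x) e_j⟩`, and these evolve
without reference to the off-diagonal ones: they follow the backward equation of a birth and death
process with birth rates `λ² ω_{j+1}` and death rates `μ² ω_j`. The weights `ν^{2j}` are in detailed
balance with these rates, since `ν^{2(j+1)} μ² = ν^{2j} λ²`. Hence the generator, weighted and
summed over `j < J`, telescopes to the boundary flux `μ² ν^{2J} ω_J (m_J - m_{J-1})`
(`sum_diagGen`). As `|m_j| ≤ ‖x‖` and `ω_J` grows only quadratically, the flux vanishes as `J → ∞`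
when `ν < 1`. Conservativity of the semigroup is never needed.

To use this, the iterates and their weak limit must be shown to be genuine, not the default value
`0`. The identity `‖P_t u‖² + ∑_ℓ ∫₀ᵗ ‖L_ℓ P_{t-s} u‖² ds = ‖u‖²` (`energy`) bounds the form
defining each iterate by `‖x‖`, so it is represented by an operator with explicit matrix entries
(`iterate_spec`). For general `x` the iterates are not monotone, so convergence comes from absolute
convergence of the Dyson series: its terms are dominated by those of the classical process started
from the constant `1` (`two_mul_norm_dyson_le`), whose sums are at most `1` (`sum_survival_le_one`).
Entrywise convergence and the uniform norm bound then give the weak limit (`tendsto_entry`).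
Finally, `norm_sum_diag_sub_le` passes to the limit in the time-integrated telescoping identity. -/

noncomputable section

/-! ### Bounded operators from forms on dense subspaces, and weak limits. -/

namespace MinimalQDS

variable {H : Type*} [NormedAddCommGroup H] [InnerProductSpace ℂ H]

/-- A bounded sesquilinear form on a dense subspace is represented by a bounded operator. -/
lemma exists_clm_of_form [CompleteSpace H] {D : Submodule ℂ H} (hD : Dense (D : Set H))
    {q : H → H → ℂ} {C : ℝ}
    (hal : ∀ v ∈ D, ∀ v' ∈ D, ∀ u ∈ D, q (v + v') u = q v u + q v' u)
    (har : ∀ v ∈ D, ∀ u ∈ D, ∀ u' ∈ D, q v (u + u') = q v u + q v u')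
    (hsl : ∀ (c : ℂ), ∀ v ∈ D, ∀ u ∈ D, q (c • v) u = starRingEnd ℂ c * q v u)
    (hsr : ∀ (c : ℂ), ∀ v ∈ D, ∀ u ∈ D, q v (c • u) = c * q v u)
    (hb : ∀ v ∈ D, ∀ u ∈ D, ‖q v u‖ ≤ C * ‖v‖ * ‖u‖) :
    ∃ A : H →L[ℂ] H, ∀ v ∈ D, ∀ u ∈ D, ⟪v, A u⟫_ℂ = q v u := by
  have hd : DenseRange D.subtype := by
    simpa [DenseRange] using hD
  have key : ∀ u : D, ∃ w : H, (∀ v ∈ D, ⟪v, w⟫_ℂ = q v u) ∧ ‖w‖ ≤ C * ‖u‖ := by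
    intro u
    -- `q` is conjugate-linear in its first argument; conjugating makes it linear, so that the Riesz
    -- representation applies to the extension of `f` to `H`.
    let f : D →ₗ[ℂ] ℂ :=
      { toFun := fun v => starRingEnd ℂ (q v u)
        map_add' := fun v v' => by
          simp [hal v v.2 v' v'.2 u u.2]
        map_smul' := fun c v => by
          simp [hsl c v v.2 u u.2] }
    have hf : ∀ v : D, ‖f v‖ ≤ C * ‖u‖ * ‖D.subtype v‖ := fun v => by
      have := hb v v.2 u u.2
      simp only [f, LinearMap.coe_mk, AddHom.coe_mk, RCLike.norm_conj, Submodule.subtype_apply]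
      calc _ ≤ _ := this
        _ = _ := by simp; ring
    -- The sign of `C` is not assumed; it is read off from the bound at `v = u ≠ 0`.
    have h0 : 0 ≤ C * ‖u‖ := by
      by_cases hu : u = 0
      · simp [hu]
      · have h1 := (norm_nonneg _).trans (hb u u.2 u u.2)
        have h2 : 0 < ‖(u : H)‖ := norm_pos_iff.2 (by simpa using hu)
        exact (mul_nonneg_iff_of_pos_right h2).1 h1
    refine ⟨(InnerProductSpace.toDual ℂ H).symm (f.extendOfNorm D.subtype), fun v hv => ?_, ?_⟩
    · rw [← inner_conj_symm, InnerProductSpace.toDual_symm_apply]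
      have := LinearMap.extendOfNorm_eq (f := f) hd ⟨_, hf⟩ ⟨v, hv⟩
      rw [Submodule.subtype_apply] at this
      rw [this]
      simp [f]
    · rw [LinearIsometryEquiv.norm_map]
      exact LinearMap.opNorm_extendOfNorm_le hd h0 hf
  choose w hw hwC using key
  have huniq : ∀ a b : H, (∀ v ∈ D, ⟪v, a⟫_ℂ = ⟪v, b⟫_ℂ) → a = b := fun a b h =>
    hD.eq_of_inner_right ℂ fun v hv => h v hv
  let g : D →ₗ[ℂ] H :=
    { toFun := w
      map_add' := fun u u' => huniq _ _ fun v hv => by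
        rw [inner_add_right, hw _ v hv, hw _ v hv, hw _ v hv]
        exact har v hv u u.2 u' u'.2
      map_smul' := fun c u => huniq _ _ fun v hv => by
        rw [RingHom.id_apply, inner_smul_right, hw _ v hv, hw _ v hv]
        exact hsr c v hv u u.2 }
  refine ⟨g.extendOfNorm D.subtype, fun v hv u hu => ?_⟩
  have := LinearMap.extendOfNorm_eq (f := g) hd ⟨C, fun u => hwC u⟩ ⟨u, hu⟩
  rw [Submodule.subtype_apply] at this
  rw [this]
  exact hw ⟨u, hu⟩ v hv

/-- A bound of a form on a dense subspace bounds the operator representing it. -/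
lemma norm_le_of_form_bound {D : Submodule ℂ H} (hD : Dense (D : Set H)) {A : H →L[ℂ] H} {C : ℝ}
    (hC : 0 ≤ C) (hb : ∀ v ∈ D, ∀ u ∈ D, ‖⟪v, A u⟫_ℂ‖ ≤ C * ‖v‖ * ‖u‖) : ‖A‖ ≤ C := by
  have h1 : ∀ v : H, ∀ u ∈ D, ‖⟪v, A u⟫_ℂ‖ ≤ C * ‖v‖ * ‖u‖ := fun v u hu => by
    refine hD.induction (P := fun v => ‖⟪v, A u⟫_ℂ‖ ≤ C * ‖v‖ * ‖u‖)
      (fun v hv => hb v hv u hu) ?_ v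
    exact isClosed_le (by fun_prop) (by fun_prop)
  have h2 : ∀ v u : H, ‖⟪v, A u⟫_ℂ‖ ≤ C * ‖v‖ * ‖u‖ := fun v u => by
    refine hD.induction (P := fun u => ‖⟪v, A u⟫_ℂ‖ ≤ C * ‖v‖ * ‖u‖) (fun u hu => h1 v u hu) ?_ u
    exact isClosed_le (by fun_prop) (by fun_prop)
  refine A.opNorm_le_bound hC fun u => ?_
  have h3 := h2 (A u) u
  rw [inner_self_eq_norm_sq_to_K, norm_pow] at h3
  simp only [Complex.coe_algebraMap, Complex.norm_real, norm_norm] at h3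
  rcases eq_or_ne ‖A u‖ 0 with h0 | h0
  · rw [h0]; positivity
  · have h4 : 0 < ‖A u‖ := lt_of_le_of_ne (norm_nonneg _) h0.symm
    nlinarith

/-- By homogeneity, a quadratic bound of a sesquilinear form implies a Cauchy-Schwarz type bound. -/
lemma form_bound_of_sq {D : Submodule ℂ H} {q : H → H → ℂ} {C : ℝ}
    (hsl : ∀ (c : ℂ), ∀ v ∈ D, ∀ u ∈ D, q (c • v) u = starRingEnd ℂ c * q v u)
    (hsr : ∀ (c : ℂ), ∀ v ∈ D, ∀ u ∈ D, q v (c • u) = c * q v u)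
    (hb : ∀ v ∈ D, ∀ u ∈ D, 2 * ‖q v u‖ ≤ C * (‖v‖ ^ 2 + ‖u‖ ^ 2)) :
    ∀ v ∈ D, ∀ u ∈ D, ‖q v u‖ ≤ C * ‖v‖ * ‖u‖ := by
  intro v hv u hu
  rcases eq_or_ne v 0 with rfl | hv0
  · have := hsl 0 0 hv u hu
    simp at this
    simp [this]
  rcases eq_or_ne u 0 with rfl | hu0
  · have := hsr 0 v hv 0 hu
    simp at this
    simp [this]
  have h1 : 0 < ‖v‖ := norm_pos_iff.2 hv0
  have h2 : 0 < ‖u‖ := norm_pos_iff.2 hu0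
  -- Rescaling both vectors to the common norm `‖u‖ ‖v‖` is the equality case of the
  -- arithmetic-geometric mean inequality, so no constant is lost.
  have h3 := hb _ (D.smul_mem (‖u‖ : ℂ) hv) _ (D.smul_mem (‖v‖ : ℂ) hu)
  rw [hsl _ v hv _ (D.smul_mem (‖v‖ : ℂ) hu), hsr _ v hv u hu] at h3
  simp only [norm_mul, norm_smul, RCLike.norm_conj, Complex.norm_real, norm_norm] at h3
  have h4 : 0 < ‖u‖ * ‖v‖ := by positivity
  have h5 : (‖u‖ * ‖v‖) * ‖q v u‖ ≤ (‖u‖ * ‖v‖) * (C * ‖v‖ * ‖u‖) := by nlinarith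
  exact le_of_mul_le_mul_left h5 h4

lemma ofForm_spec {D : Submodule ℂ H} {q : H → H → ℂ}
    (h : ∃ A : H →L[ℂ] H, ∀ v ∈ D, ∀ u ∈ D, ⟪v, A u⟫_ℂ = q v u) :
    ∀ v ∈ D, ∀ u ∈ D, ⟪v, ofForm D q u⟫_ℂ = q v u := by
  rw [ofForm, dif_pos h]
  exact h.choose_spec

lemma weakLimit_spec {A : ℕ → H →L[ℂ] H} (h : ∃ B : H →L[ℂ] H,
    ∀ v u : H, Tendsto (fun n => ⟪v, A n u⟫_ℂ) atTop (𝓝 ⟪v, B u⟫_ℂ)) :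
    ∀ v u : H, Tendsto (fun n => ⟪v, A n u⟫_ℂ) atTop (𝓝 ⟪v, weakLimit A u⟫_ℂ) := by
  rw [weakLimit, dif_pos h]
  exact h.choose_spec

/-- If a uniformly Lipschitz sequence of functions converges on a dense set, it converges everywhere. -/
lemma cauchySeq_of_dense {E : Type*} [SeminormedAddCommGroup E] {D : Set E} (hD : Dense D)
    {f : ℕ → E → ℂ} {K : ℝ}
    (hf : ∀ n a b, ‖f n a - f n b‖ ≤ K * ‖a - b‖) (hc : ∀ a ∈ D, CauchySeq fun n => f n a) (a : E) :
    CauchySeq fun n => f n a := by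
  rw [Metric.cauchySeq_iff']
  intro ε hε
  have hK : 0 < |K| + 1 := by positivity
  obtain ⟨b, hb, hab⟩ := Metric.mem_closure_iff.1 (hD a) (ε / (3 * (|K| + 1))) (by positivity)
  obtain ⟨N, hN⟩ := Metric.cauchySeq_iff'.1 (hc b hb) (ε / 3) (by positivity)
  refine ⟨N, fun n hn => ?_⟩
  have h1 : ∀ n, ‖f n a - f n b‖ < ε / 3 := fun n => by
    have h2 := hf n a b
    rw [dist_eq_norm] at hab
    calc _ ≤ _ := h2
      _ ≤ (|K| + 1) * ‖a - b‖ := by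
        gcongr
        linarith [le_abs_self K]
      _ < (|K| + 1) * (ε / (3 * (|K| + 1))) := by gcongr
      _ = ε / 3 := by field_simp
  have h3 := hN n hn
  rw [dist_eq_norm] at h3 ⊢
  have e1 : f n a - f N a = (f n a - f n b) + (f n b - f N b) - (f N a - f N b) := by ring
  rw [e1]
  have := norm_sub_le ((f n a - f n b) + (f n b - f N b)) (f N a - f N b)
  have := norm_add_le (f n a - f n b) (f n b - f N b)
  linarith [h1 n, h1 N]

/-- A bounded sequence of operators whose form converges on a dense set converges weakly. -/
lemma exists_weakLimit [CompleteSpace H] {D : Set H} (hD : Dense D) {A : ℕ → H →L[ℂ] H} {C : ℝ}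
    (hA : ∀ n, ‖A n‖ ≤ C) (hc : ∀ v ∈ D, ∀ u ∈ D, CauchySeq fun n => ⟪v, A n u⟫_ℂ) :
    ∃ B : H →L[ℂ] H, ∀ v u : H, Tendsto (fun n => ⟪v, A n u⟫_ℂ) atTop (𝓝 ⟪v, B u⟫_ℂ) := by
  have hb : ∀ n v u, ‖⟪v, A n u⟫_ℂ‖ ≤ C * ‖v‖ * ‖u‖ := fun n v u => by
    calc _ ≤ ‖v‖ * ‖A n u‖ := norm_inner_le_norm _ _
      _ ≤ ‖v‖ * (C * ‖u‖) := by
        gcongr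
        exact (A n).le_of_opNorm_le (hA n) u
      _ = _ := by ring
  have h1 : ∀ v ∈ D, ∀ u, CauchySeq fun n => ⟪v, A n u⟫_ℂ := fun v hv u =>
    cauchySeq_of_dense (K := C * ‖v‖) hD (fun n a b => by
      rw [← inner_sub_right, ← map_sub]
      exact hb n v (a - b)) (hc v hv) u
  have h2 : ∀ v u, CauchySeq fun n => ⟪v, A n u⟫_ℂ := fun v u =>
    cauchySeq_of_dense (f := fun n v => ⟪v, A n u⟫_ℂ) (K := C * ‖u‖) hD (fun n a b => by
      rw [← inner_sub_left]
      exact (hb n (a - b) u).trans_eq (by ring)) (fun v hv => h1 v hv u) v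
  choose q hq using fun v u => cauchySeq_tendsto_of_complete (h2 v u)
  obtain ⟨B, hB⟩ := exists_clm_of_form (D := (⊤ : Submodule ℂ H)) (q := q) (C := C) (by simp)
    (fun v _ v' _ u _ => tendsto_nhds_unique (hq _ _)
      (((hq v u).add (hq v' u)).congr fun n => (inner_add_left _ _ _).symm))
    (fun v _ u _ u' _ => tendsto_nhds_unique (hq _ _)
      (((hq v u).add (hq v u')).congr fun n => by rw [map_add, inner_add_right]))
    (fun c v _ u _ => tendsto_nhds_unique (hq _ _)
      (((hq v u).const_mul _).congr fun n => (inner_smul_left _ _ _).symm))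
    (fun c v _ u _ => tendsto_nhds_unique (hq _ _)
      (((hq v u).const_mul _).congr fun n => by rw [map_smul, inner_smul_right]))
    (fun v _ u _ => le_of_tendsto (hq v u).norm (Eventually.of_forall fun n => hb n v u))
  refine ⟨B, fun v u => ?_⟩
  rw [hB v trivial u trivial]
  exact hq v u

lemma applyOrZero_of_mem (L : H →ₗ.[ℂ] H) {u : H} (hu : u ∈ L.domain) :
    applyOrZero L u = L ⟨u, hu⟩ := by
  rw [applyOrZero, dif_pos hu]

lemma applyOrZero_add (L : H →ₗ.[ℂ] H) {u v : H} (hu : u ∈ L.domain) (hv : v ∈ L.domain) :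
    applyOrZero L (u + v) = applyOrZero L u + applyOrZero L v := by
  rw [applyOrZero_of_mem L hu, applyOrZero_of_mem L hv,
    applyOrZero_of_mem L (L.domain.add_mem hu hv), ← L.map_add]
  rfl

lemma applyOrZero_smul (L : H →ₗ.[ℂ] H) (c : ℂ) {u : H} (hu : u ∈ L.domain) :
    applyOrZero L (c • u) = c • applyOrZero L u := by
  rw [applyOrZero_of_mem L hu, applyOrZero_of_mem L (L.domain.smul_mem c hu), ← L.map_smul]
  rfl

end MinimalQDS
-- Coordinates: the basis, the semigroup `P` and the jump operators.
namespace QuadraticOscillator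

open MinimalQDS MeasureTheory

lemma omega_zero (r : ℝ) : omega r 0 = 0 := by simp [omega]

lemma omega_nonneg {r : ℝ} (hr : 0 < r) (k : ℕ) : 0 ≤ omega r k := by
  rcases Nat.eq_zero_or_pos k with rfl | hk
  · simp [omega]
  · have : (1 : ℝ) ≤ k := by exact_mod_cast hk
    exact mul_nonneg k.cast_nonneg (by linarith)

/-- The total jump rate of the diagonal birth and death process out of the state `n`. -/
def jumpRate (r lam mu : ℝ) (n : ℕ) : ℝ := lam ^ 2 * omega r (n + 1) + mu ^ 2 * omega r n

lemma jumpRate_nonneg {r : ℝ} (hr : 0 < r) (lam mu : ℝ) (n : ℕ) : 0 ≤ jumpRate r lam mu n := by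
  have h1 := omega_nonneg hr n
  have h2 := omega_nonneg hr (n + 1)
  unfold jumpRate
  positivity

lemma rate_re (r lam mu ζp ζm : ℝ) (n : ℕ) :
    (rate r lam mu ζp ζm n).re = jumpRate r lam mu n / 2 := by
  simp [rate, jumpRate, ← Complex.ofReal_pow]
  ring

lemma norm_exp_mul_rate (r lam mu ζp ζm t : ℝ) (n : ℕ) :
    ‖Complex.exp (-(t : ℂ) * rate r lam mu ζp ζm n)‖ ^ 2 = Real.exp (-t * jumpRate r lam mu n) := by
  rw [Complex.norm_exp, ← Real.exp_nat_mul]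
  simp [rate_re]
  ring

lemma norm_sq_eq_tsum (u : Fock) : ‖u‖ ^ 2 = ∑' n, ‖u n‖ ^ 2 := by
  have h1 := lp.norm_rpow_eq_tsum (p := 2) (by norm_num) u
  norm_num at h1
  exact h1

lemma inner_e (j : ℕ) (u : Fock) : ⟪e j, u⟫_ℂ = u j := by
  rw [e, lp.inner_single_left]
  simp

lemma norm_e (j : ℕ) : ‖e j‖ = 1 := by
  rw [e, lp.norm_single (by norm_num)]
  simp

lemma e_apply (k n : ℕ) : e k n = if n = k then 1 else 0 := by
  rw [e, lp.single_apply, Pi.single_apply]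

lemma e_mem_domN (k j : ℕ) : e j ∈ domN k := by
  change Summable _
  refine summable_of_ne_finset_zero (s := {j}) fun n hn => ?_
  rw [Finset.mem_singleton] at hn
  simp [e_apply, hn]

lemma hasSum_e (u : Fock) : HasSum (fun n => u n • e n) u := by
  have := lp.hasSum_single (E := fun _ : ℕ => ℂ) (p := 2) (by norm_num) u
  refine this.congr_fun fun n => ?_
  rw [e, ← lp.single_smul, smul_eq_mul, mul_one]

lemma dense_span_e : Dense (Submodule.span ℂ (Set.range e) : Set Fock) := by
  intro u
  refine mem_closure_of_tendsto (hasSum_e u) (Eventually.of_forall fun s => ?_)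
  exact Submodule.sum_mem _ fun n _ => Submodule.smul_mem _ _ (Submodule.subset_span ⟨n, rfl⟩)

lemma dense_domN (k : ℕ) : Dense (domN k : Set Fock) := by
  refine dense_span_e.mono ?_
  rw [SetLike.coe_subset_coe, Submodule.span_le]
  rintro _ ⟨j, rfl⟩
  exact e_mem_domN k j

section Semigroup

variable {r : ℝ} (hr : 0 < r) (lam mu ζp ζm : ℝ)

include hr

lemma norm_P_apply_sq {t : ℝ} (ht : 0 ≤ t) (u : Fock) (n : ℕ) :
    ‖P r lam mu ζp ζm t u n‖ ^ 2 = Real.exp (-t * jumpRate r lam mu n) * ‖u n‖ ^ 2 := by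
  rw [P_apply hr ht, norm_mul, mul_pow, norm_exp_mul_rate]

lemma norm_P_apply_sq_le {t : ℝ} (ht : 0 ≤ t) (u : Fock) (n : ℕ) :
    ‖P r lam mu ζp ζm t u n‖ ^ 2 ≤ ‖u n‖ ^ 2 := by
  rw [norm_P_apply_sq hr _ _ _ _ ht]
  refine mul_le_of_le_one_left (by positivity) ?_
  rw [Real.exp_le_one_iff]
  have := mul_nonneg ht (jumpRate_nonneg hr lam mu n)
  linarith

lemma P_mem_domN {t : ℝ} (ht : 0 ≤ t) (k : ℕ) {u : Fock} (hu : u ∈ domN k) :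
    P r lam mu ζp ζm t u ∈ domN k := by
  change Summable _
  have hu' : Summable fun n : ℕ => ((n : ℝ) ^ k) ^ 2 * ‖u n‖ ^ 2 := hu
  refine Summable.of_nonneg_of_le (fun n => by positivity) (fun n => ?_) hu'
  have := norm_P_apply_sq_le hr lam mu ζp ζm ht u n
  gcongr

lemma P_e {t : ℝ} (ht : 0 ≤ t) (k : ℕ) :
    P r lam mu ζp ζm t (e k) = Complex.exp (-(t : ℂ) * rate r lam mu ζp ζm k) • e k := by
  ext n
  rw [P_apply hr ht]
  by_cases h : n = k <;> simp [e_apply, h]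

end Semigroup

lemma L_domain (r lam mu : ℝ) (ℓ : Fin 2) : (L r lam mu ℓ).domain = domN 1 := by
  fin_cases ℓ <;> rfl

lemma L_zero_apply (r lam mu : ℝ) {u : Fock} (hu : u ∈ domN 1) (n : ℕ) :
    applyOrZero (L r lam mu 0) u n = mu * (Real.sqrt (omega r (n + 1)) * u (n + 1)) := by
  have hu' : u ∈ (L r lam mu 0).domain := hu
  rw [applyOrZero_of_mem _ hu']
  rfl

lemma L_one_apply_zero (r lam mu : ℝ) {u : Fock} (hu : u ∈ domN 1) :
    applyOrZero (L r lam mu 1) u 0 = 0 := by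
  have hu' : u ∈ (L r lam mu 1).domain := hu
  rw [applyOrZero_of_mem _ hu']
  exact mul_zero (lam : ℂ)

lemma L_one_apply_succ (r lam mu : ℝ) {u : Fock} (hu : u ∈ domN 1) (n : ℕ) :
    applyOrZero (L r lam mu 1) u (n + 1) = lam * (Real.sqrt (omega r (n + 1)) * u n) := by
  have hu' : u ∈ (L r lam mu 1).domain := hu
  rw [applyOrZero_of_mem _ hu']
  rfl

/-- At `k = 0` the truncated `k - 1` is harmless, because `ω_0 = 0`. -/
lemma L_zero_e (r lam mu : ℝ) (k : ℕ) :
    applyOrZero (L r lam mu 0) (e k) = ((mu * Real.sqrt (omega r k) : ℝ) : ℂ) • e (k - 1) := by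
  ext n
  rw [L_zero_apply r lam mu (e_mem_domN 1 k)]
  rcases k with _ | k
  · simp [e_apply, omega_zero]
  · by_cases h : n = k <;> simp [e_apply, h]

lemma L_one_e (r lam mu : ℝ) (k : ℕ) :
    applyOrZero (L r lam mu 1) (e k) =
      ((lam * Real.sqrt (omega r (k + 1)) : ℝ) : ℂ) • e (k + 1) := by
  ext n
  rcases n with _ | n
  · rw [L_one_apply_zero r lam mu (e_mem_domN 1 k)]
    simp [e_apply]
  · rw [L_one_apply_succ r lam mu (e_mem_domN 1 k)]
    by_cases h : n = k <;> simp [e_apply, h]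

/-! ### Energy balance between the decay of `P` and the jumps. -/

section Energy

variable {r : ℝ} (hr : 0 < r) (lam mu ζp ζm : ℝ)

include hr

/-- As a quadratic form, `∑_ℓ L_ℓ* L_ℓ` is diagonal, with eigenvalues equal to twice the real parts
of the decay rates of `P`. This is the exact compensation behind `energy`. -/
lemma hasSum_norm_sq_L {u : Fock} (hu : u ∈ domN 1) :
    HasSum (fun n => jumpRate r lam mu n * ‖u n‖ ^ 2)
      (∑ ℓ, ‖applyOrZero (L r lam mu ℓ) u‖ ^ 2) := by
  have hs : ∀ (c : ℝ) (k : ℕ) (z : ℂ), ‖(c : ℂ) * (Real.sqrt (omega r k) * z)‖ ^ 2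
      = c ^ 2 * omega r k * ‖z‖ ^ 2 := fun c k z => by
    rw [norm_mul, norm_mul, Complex.norm_real, Complex.norm_real, mul_pow, mul_pow,
      Real.norm_eq_abs, Real.norm_eq_abs, sq_abs, sq_abs, Real.sq_sqrt (omega_nonneg hr k)]
    ring
  rw [Fin.sum_univ_two]
  have h0 : HasSum (fun n => mu ^ 2 * omega r n * ‖u n‖ ^ 2)
      (‖applyOrZero (L r lam mu 0) u‖ ^ 2) := by
    -- `B` shifts the index down; the term dropped at `n = 0` vanishes because `ω_0 = 0`.
    rw [← hasSum_nat_add_iff' 1]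
    have := (summable_sq (applyOrZero (L r lam mu 0) u)).hasSum
    rw [← norm_sq_eq_tsum] at this
    simp only [L_zero_apply r lam mu hu, hs] at this
    simpa [omega_zero] using this
  have h1 : HasSum (fun n => lam ^ 2 * omega r (n + 1) * ‖u n‖ ^ 2)
      (‖applyOrZero (L r lam mu 1) u‖ ^ 2) := by
    have := (summable_sq (applyOrZero (L r lam mu 1) u)).hasSum
    rw [← norm_sq_eq_tsum, ← hasSum_nat_add_iff' 1] at this
    simp only [L_one_apply_succ r lam mu hu, hs] at this
    simpa [L_one_apply_zero r lam mu hu] using this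
  refine (h0.add h1).congr_fun fun n => ?_
  unfold jumpRate
  ring

lemma summable_jumpRate {u : Fock} (hu : u ∈ domN 1) :
    Summable fun n => jumpRate r lam mu n * ‖u n‖ ^ 2 := (hasSum_norm_sq_L hr lam mu hu).summable

lemma sum_norm_sq_L_P {t : ℝ} (ht : 0 ≤ t) {u : Fock} (hu : u ∈ domN 1) :
    ∑ ℓ, ‖applyOrZero (L r lam mu ℓ) (P r lam mu ζp ζm t u)‖ ^ 2
      = ∑' n, jumpRate r lam mu n * (Real.exp (-t * jumpRate r lam mu n) * ‖u n‖ ^ 2) := by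
  rw [← (hasSum_norm_sq_L hr lam mu (P_mem_domN hr lam mu ζp ζm ht 1 hu)).tsum_eq]
  simp_rw [norm_P_apply_sq hr _ _ _ _ ht]

/-- `‖P_t u‖² + ∑_ℓ ∫₀ᵗ ‖L_ℓ P_{t-s} u‖² ds = ‖u‖²`, with integrability of the integrand. -/
lemma energy {t : ℝ} (ht : 0 ≤ t) {u : Fock} (hu : u ∈ domN 1) :
    IntervalIntegrable
      (fun s => ∑ ℓ, ‖applyOrZero (L r lam mu ℓ) (P r lam mu ζp ζm (t - s) u)‖ ^ 2) volume 0 t ∧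
    ‖P r lam mu ζp ζm t u‖ ^ 2
      + ∫ s in (0 : ℝ)..t, ∑ ℓ, ‖applyOrZero (L r lam mu ℓ) (P r lam mu ζp ζm (t - s) u)‖ ^ 2
      = ‖u‖ ^ 2 := by
  set q := jumpRate r lam mu with hq
  have hq0 : ∀ n, 0 ≤ q n := jumpRate_nonneg hr lam mu
  set F : ℕ → ℝ → ℝ := fun n s => q n * (Real.exp (-(t - s) * q n) * ‖u n‖ ^ 2) with hF
  have hsum := summable_jumpRate hr lam mu hu
  have hFb : ∀ n, ∀ s ∈ Set.Icc 0 t, ‖F n s‖ ≤ q n * ‖u n‖ ^ 2 := fun n s hs => by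
    have h1 := hq0 n
    rw [hF, Real.norm_of_nonneg (by positivity)]
    refine mul_le_mul_of_nonneg_left (mul_le_of_le_one_left (by positivity) ?_) h1
    rw [Real.exp_le_one_iff]
    nlinarith [mul_nonneg (sub_nonneg.2 hs.2) h1]
  have hFc : ∀ n, Continuous (F n) := fun n => by fun_prop
  have heq : ∀ s ∈ Set.uIcc 0 t,
      ∑ ℓ, ‖applyOrZero (L r lam mu ℓ) (P r lam mu ζp ζm (t - s) u)‖ ^ 2 = ∑' n, F n s :=
    fun s hs => by
      rw [Set.uIcc_of_le ht] at hs
      exact sum_norm_sq_L_P hr lam mu ζp ζm (sub_nonneg.2 hs.2) hu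
  have hcont : ContinuousOn (fun s => ∑' n, F n s) (Set.uIcc 0 t) := by
    rw [Set.uIcc_of_le ht]
    exact continuousOn_tsum (fun n => (hFc n).continuousOn) hsum hFb
  have hint : IntervalIntegrable (fun s => ∑' n, F n s) volume 0 t := hcont.intervalIntegrable
  refine ⟨hint.congr fun s hs => (heq s (Set.uIoc_subset_uIcc hs)).symm, ?_⟩
  rw [intervalIntegral.integral_congr heq]
  have h2 : HasSum (fun n => ∫ s in (0 : ℝ)..t, F n s) (∫ s in (0 : ℝ)..t, ∑' n, F n s) := by
    refine intervalIntegral.hasSum_integral_of_dominated_convergence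
      (fun n _ => q n * ‖u n‖ ^ 2) (fun n => (hFc n).aestronglyMeasurable) ?_ ?_ ?_ ?_
    · refine fun n => Eventually.of_forall fun s hs => ?_
      rw [Set.uIoc_of_le ht] at hs
      exact hFb n s (Set.Ioc_subset_Icc_self hs)
    · exact Eventually.of_forall fun s _ => hsum
    · exact intervalIntegrable_const
    · refine Eventually.of_forall fun s hs => ?_
      rw [Set.uIoc_of_le ht] at hs
      exact (Summable.of_norm_bounded hsum
        fun n => hFb n s (Set.Ioc_subset_Icc_self hs)).hasSum
  -- Each `F n` is an exact derivative in `s`; the value at `s = 0` is the `n`-th term of `‖P_t u‖²`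
  -- and cancels against it.
  have h3 : ∀ n, ∫ s in (0 : ℝ)..t, F n s = ‖u n‖ ^ 2 - Real.exp (-t * q n) * ‖u n‖ ^ 2 := by
    intro n
    have hd : ∀ s ∈ Set.uIcc 0 t,
        HasDerivAt (fun s => Real.exp (-(t - s) * q n) * ‖u n‖ ^ 2) (F n s) s := fun s _ => by
      have h4 : HasDerivAt (fun s : ℝ => -(t - s) * q n) (q n) s := by
        simpa using (((hasDerivAt_id s).const_sub t).neg.mul_const (q n))
      refine (h4.exp.mul_const (‖u n‖ ^ 2)).congr_deriv ?_
      simp only [hF]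
      ring
    rw [intervalIntegral.integral_eq_sub_of_hasDerivAt hd ((hFc n).intervalIntegrable _ _)]
    simp
  have h5 := (summable_sq (P r lam mu ζp ζm t u)).hasSum.add h2
  rw [← norm_sq_eq_tsum] at h5
  have h6 := (summable_sq u).hasSum
  rw [← norm_sq_eq_tsum] at h6
  refine h5.unique (h6.congr_fun fun n => ?_)
  rw [h3, norm_P_apply_sq hr _ _ _ _ ht]
  ring

end Energy

/-! ### Measurability from matrix entries. -/

lemma aemeasurable_of_hasSum {μ : Measure ℝ} {f : ℕ → ℝ → ℂ} {g : ℝ → ℂ}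
    (hf : ∀ n, AEMeasurable (f n) μ) (h : ∀ s, HasSum (fun n => f n s) (g s)) :
    AEMeasurable g μ :=
  aemeasurable_of_tendsto_metrizable_ae atTop
    (fun N => Finset.aemeasurable_fun_sum (Finset.range N) fun n _ => hf n)
    (Eventually.of_forall fun s => (h s).tendsto_sum_nat)

/-- The iterates are obtained by choice at each time, so their dependence on `s` is controlled only
through matrix entries. Expanding in the basis twice writes the inner product as a limit of finite
sums of measurable scalar functions. -/
lemma aemeasurable_inner_of_entries {μ : Measure ℝ} {w w' : ℝ → Fock} {A : ℝ → Fock →L[ℂ] Fock}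
    (hw : ∀ j, AEMeasurable (fun s => w s j) μ) (hw' : ∀ j, AEMeasurable (fun s => w' s j) μ)
    (hA : ∀ j k, AEMeasurable (fun s => ⟪e j, A s (e k)⟫_ℂ) μ) :
    AEMeasurable (fun s => ⟪w s, A s (w' s)⟫_ℂ) μ := by
  have h1 : ∀ j, AEMeasurable (fun s => A s (w' s) j) μ := fun j => by
    refine aemeasurable_of_hasSum (f := fun k s => w' s k * ⟪e j, A s (e k)⟫_ℂ)
      (fun k => (hw' k).mul (hA j k)) fun s => ?_
    have h2 := (innerSL ℂ (e j) ∘L A s).hasSum (hasSum_e (w' s))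
    simpa [inner_e] using h2
  refine aemeasurable_of_hasSum (f := fun j s => A s (w' s) j * starRingEnd ℂ (w s j))
    (fun j => (h1 j).mul (Complex.continuous_conj.measurable.comp_aemeasurable (hw j))) fun s => ?_
  exact lp.hasSum_inner (w s) (A s (w' s))

/-! ### The Duhamel recursion for matrix entries. -/

/-- The decay rate of the matrix entry `(j, k)`. -/
def pairRate (r lam mu ζp ζm : ℝ) (j k : ℕ) : ℂ :=
  starRingEnd ℂ (rate r lam mu ζp ζm j) + rate r lam mu ζp ζm k

/-- The matrix of `∑_ℓ L_ℓ* X L_ℓ` in terms of the matrix `f` of `X`. -/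
def gain (r lam mu : ℝ) (f : ℕ → ℕ → ℝ → ℂ) (j k : ℕ) (s : ℝ) : ℂ :=
  ((mu ^ 2 * Real.sqrt (omega r j) * Real.sqrt (omega r k) : ℝ) : ℂ) * f (j - 1) (k - 1) s
    + ((lam ^ 2 * Real.sqrt (omega r (j + 1)) * Real.sqrt (omega r (k + 1)) : ℝ) : ℂ)
      * f (j + 1) (k + 1) s

/-- The matrix of `∑_ℓ ∫₀ᵗ P_{t-s}* L_ℓ* X_s L_ℓ P_{t-s} ds` in terms of the matrix `f` of `X`. -/
def duhamel (r lam mu ζp ζm : ℝ) (f : ℕ → ℕ → ℝ → ℂ) (j k : ℕ) (t : ℝ) : ℂ :=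
  ∫ s in (0 : ℝ)..t, Complex.exp (-((t - s : ℝ) : ℂ) * pairRate r lam mu ζp ζm j k)
    * gain r lam mu f j k s

/-- The matrix of `P_t* x P_t`. -/
def free (r lam mu ζp ζm : ℝ) (x : Fock →L[ℂ] Fock) (j k : ℕ) (t : ℝ) : ℂ :=
  Complex.exp (-(t : ℂ) * pairRate r lam mu ζp ζm j k) * ⟪e j, x (e k)⟫_ℂ

/-- The matrices of the iterates. -/
def entry (r lam mu ζp ζm : ℝ) (x : Fock →L[ℂ] Fock) : ℕ → ℕ → ℕ → ℝ → ℂ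
  | 0 => free r lam mu ζp ζm x
  | n + 1 => fun j k t => free r lam mu ζp ζm x j k t
      + duhamel r lam mu ζp ζm (entry r lam mu ζp ζm x n) j k t

lemma pairRate_re (r lam mu ζp ζm : ℝ) (j k : ℕ) :
    (pairRate r lam mu ζp ζm j k).re = (jumpRate r lam mu j + jumpRate r lam mu k) / 2 := by
  simp [pairRate, rate_re]
  ring

lemma continuous_gain (r lam mu : ℝ) {f : ℕ → ℕ → ℝ → ℂ} (hf : ∀ j k, Continuous (f j k))
    (j k : ℕ) : Continuous (gain r lam mu f j k) := by
  have h1 := hf (j - 1) (k - 1)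
  have h2 := hf (j + 1) (k + 1)
  unfold gain
  fun_prop

/-- Taking the `t`-dependent exponential out leaves `t` only in a factor and in the upper limit,
ready for the product rule and the fundamental theorem of calculus. -/
lemma duhamel_eq (r lam mu ζp ζm : ℝ) (f : ℕ → ℕ → ℝ → ℂ) (j k : ℕ) (t : ℝ) :
    duhamel r lam mu ζp ζm f j k t = Complex.exp (-(t : ℂ) * pairRate r lam mu ζp ζm j k) *
      ∫ s in (0 : ℝ)..t, Complex.exp ((s : ℂ) * pairRate r lam mu ζp ζm j k)
        * gain r lam mu f j k s := by
  rw [duhamel, ← intervalIntegral.integral_const_mul]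
  refine intervalIntegral.integral_congr fun s _ => ?_
  rw [← mul_assoc, ← Complex.exp_add]
  congr 2
  push_cast
  ring

lemma hasDerivAt_free (r lam mu ζp ζm : ℝ) (x : Fock →L[ℂ] Fock) (j k : ℕ) (t : ℝ) :
    HasDerivAt (free r lam mu ζp ζm x j k)
      (-pairRate r lam mu ζp ζm j k * free r lam mu ζp ζm x j k t) t := by
  have h := ((((hasDerivAt_id t).ofReal_comp).neg.mul_const
    (pairRate r lam mu ζp ζm j k)).cexp).mul_const ⟪e j, x (e k)⟫_ℂ
  refine h.congr_deriv ?_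
  simp [free]
  ring

lemma hasDerivAt_duhamel (r lam mu ζp ζm : ℝ) {f : ℕ → ℕ → ℝ → ℂ}
    (hf : ∀ j k, Continuous (f j k)) (j k : ℕ) (t : ℝ) :
    HasDerivAt (duhamel r lam mu ζp ζm f j k)
      (-pairRate r lam mu ζp ζm j k * duhamel r lam mu ζp ζm f j k t
        + gain r lam mu f j k t) t := by
  have hg := continuous_gain r lam mu hf j k
  have hc : Continuous fun s : ℝ => Complex.exp ((s : ℂ) * pairRate r lam mu ζp ζm j k)
      * gain r lam mu f j k s := by fun_prop
  have h1 := (((hasDerivAt_id t).ofReal_comp).neg.mul_const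
    (pairRate r lam mu ζp ζm j k)).cexp
  have h2 := h1.mul (intervalIntegral.integral_hasDerivAt_right (hc.intervalIntegrable 0 t)
    (hc.stronglyMeasurableAtFilter _ _) hc.continuousAt)
  have h3 : duhamel r lam mu ζp ζm f j k = _ := funext (duhamel_eq r lam mu ζp ζm f j k)
  rw [h3]
  refine h2.congr_deriv ?_
  have h4 : Complex.exp (-(t : ℂ) * pairRate r lam mu ζp ζm j k)
      * (Complex.exp ((t : ℂ) * pairRate r lam mu ζp ζm j k)) = 1 := by
    rw [← Complex.exp_add]
    simp
  simp only [id_eq, Complex.ofReal_one]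
  linear_combination gain r lam mu f j k t * h4

lemma continuous_free (r lam mu ζp ζm : ℝ) (x : Fock →L[ℂ] Fock) (j k : ℕ) :
    Continuous (free r lam mu ζp ζm x j k) :=
  continuous_iff_continuousAt.2 fun t => (hasDerivAt_free r lam mu ζp ζm x j k t).continuousAt

lemma continuous_duhamel (r lam mu ζp ζm : ℝ) {f : ℕ → ℕ → ℝ → ℂ}
    (hf : ∀ j k, Continuous (f j k)) (j k : ℕ) : Continuous (duhamel r lam mu ζp ζm f j k) :=
  continuous_iff_continuousAt.2 fun t =>
    (hasDerivAt_duhamel r lam mu ζp ζm hf j k t).continuousAt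

lemma continuous_entry (r lam mu ζp ζm : ℝ) (x : Fock →L[ℂ] Fock) (n j k : ℕ) :
    Continuous (entry r lam mu ζp ζm x n j k) := by
  induction n generalizing j k with
  | zero => exact continuous_free r lam mu ζp ζm x j k
  | succ n ih =>
    exact (continuous_free r lam mu ζp ζm x j k).add (continuous_duhamel r lam mu ζp ζm ih j k)

/-! ### The iterates exist, are bounded by `‖x‖` and have the expected entries. -/

section Step

variable {r : ℝ} (hr : 0 < r) (lam mu ζp ζm : ℝ)

include hr

lemma norm_P_le {t : ℝ} (ht : 0 ≤ t) (u : Fock) : ‖P r lam mu ζp ζm t u‖ ≤ ‖u‖ := by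
  rw [← sq_le_sq₀ (norm_nonneg _) (norm_nonneg _), norm_sq_eq_tsum, norm_sq_eq_tsum]
  exact (summable_sq _).tsum_le_tsum (norm_P_apply_sq_le hr lam mu ζp ζm ht u) (summable_sq u)

lemma aemeasurable_L_P {t : ℝ} {u : Fock} (hu : u ∈ domN 1) (ℓ : Fin 2) (n : ℕ) :
    AEMeasurable (fun s => applyOrZero (L r lam mu ℓ) (P r lam mu ζp ζm (t - s) u) n)
      (volume.restrict (Set.Ioc 0 t)) := by
  have hP : ∀ s ∈ Set.Ioc 0 t, P r lam mu ζp ζm (t - s) u ∈ domN 1 := fun s hs =>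
    P_mem_domN hr lam mu ζp ζm (sub_nonneg.2 hs.2) 1 hu
  have hPc : ∀ n, ContinuousOn (fun s => P r lam mu ζp ζm (t - s) u n) (Set.Ioc 0 t) := fun n => by
    have : Continuous fun s : ℝ =>
      Complex.exp (-((t - s : ℝ) : ℂ) * rate r lam mu ζp ζm n) * u n := by fun_prop
    exact this.continuousOn.congr fun s hs => P_apply hr (sub_nonneg.2 hs.2) lam mu ζp ζm u n
  refine ContinuousOn.aemeasurable ?_ measurableSet_Ioc
  fin_cases ℓ
  · exact (((hPc (n + 1)).const_mul _).const_mul _).congr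
      fun s hs => L_zero_apply r lam mu (hP s hs) n
  · cases n with
    | zero =>
      exact ContinuousOn.congr (f := fun _ => (0 : ℂ)) continuousOn_const
        fun s hs => L_one_apply_zero r lam mu (hP s hs)
    | succ n =>
      exact (((hPc n).const_mul _).const_mul _).congr
        fun s hs => L_one_apply_succ r lam mu (hP s hs) n

omit hr in
lemma two_mul_norm_inner_le {A : Fock →L[ℂ] Fock} {C : ℝ} (hA : ‖A‖ ≤ C) (v u : Fock) :
    2 * ‖⟪v, A u⟫_ℂ‖ ≤ C * (‖v‖ ^ 2 + ‖u‖ ^ 2) := by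
  have hC : 0 ≤ C := (norm_nonneg _).trans hA
  have h1 : ‖⟪v, A u⟫_ℂ‖ ≤ ‖v‖ * (C * ‖u‖) :=
    (norm_inner_le_norm _ _).trans (by gcongr; exact A.le_of_opNorm_le hA u)
  nlinarith [mul_nonneg hC (sq_nonneg (‖v‖ - ‖u‖))]

variable {A : ℝ → Fock →L[ℂ] Fock} {C : ℝ} {M : ℕ → ℕ → ℝ → ℂ} {t : ℝ}

lemma intervalIntegrable_inner (hA : ∀ s, 0 ≤ s → ‖A s‖ ≤ C) (hM : ∀ j k, Continuous (M j k))
    (hAM : ∀ s, 0 ≤ s → ∀ j k, ⟪e j, A s (e k)⟫_ℂ = M j k s) (ht : 0 ≤ t)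
    {v u : Fock} (hv : v ∈ domN 1) (hu : u ∈ domN 1) (ℓ : Fin 2) :
    IntervalIntegrable (fun s => ⟪applyOrZero (L r lam mu ℓ) (P r lam mu ζp ζm (t - s) v),
      A s (applyOrZero (L r lam mu ℓ) (P r lam mu ζp ζm (t - s) u))⟫_ℂ) volume 0 t := by
  have hv2 := (energy hr lam mu ζp ζm ht hv).1
  have hu2 := (energy hr lam mu ζp ζm ht hu).1
  refine ((hv2.add hu2).const_mul C).mono_fun' ?_ ?_
  · rw [Set.uIoc_of_le ht]
    refine (aemeasurable_inner_of_entries (aemeasurable_L_P hr lam mu ζp ζm hv ℓ)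
      (aemeasurable_L_P hr lam mu ζp ζm hu ℓ) fun j k => ?_).aestronglyMeasurable
    refine (hM j k).aemeasurable.congr ?_
    filter_upwards [ae_restrict_mem measurableSet_Ioc] with s hs
    exact (hAM s hs.1.le j k).symm
  · rw [Set.uIoc_of_le ht]
    filter_upwards [ae_restrict_mem measurableSet_Ioc] with s hs
    have h1 := two_mul_norm_inner_le (hA s hs.1.le)
      (applyOrZero (L r lam mu ℓ) (P r lam mu ζp ζm (t - s) v))
      (applyOrZero (L r lam mu ℓ) (P r lam mu ζp ζm (t - s) u))
    have hC : 0 ≤ C := (norm_nonneg _).trans (hA 0 le_rfl)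
    have h2 : ∀ w : Fock, ‖applyOrZero (L r lam mu ℓ) (P r lam mu ζp ζm (t - s) w)‖ ^ 2 ≤
        ∑ ℓ, ‖applyOrZero (L r lam mu ℓ) (P r lam mu ζp ζm (t - s) w)‖ ^ 2 := fun w =>
      Finset.single_le_sum (f := fun ℓ =>
        ‖applyOrZero (L r lam mu ℓ) (P r lam mu ζp ζm (t - s) w)‖ ^ 2)
        (fun _ _ => by positivity) (Finset.mem_univ ℓ)
    have h3 := mul_le_mul_of_nonneg_left (add_le_add (h2 v) (h2 u)) hC
    have h4 := norm_nonneg (⟪applyOrZero (L r lam mu ℓ) (P r lam mu ζp ζm (t - s) v),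
      A s (applyOrZero (L r lam mu ℓ) (P r lam mu ζp ζm (t - s) u))⟫_ℂ)
    linarith

omit hr in
variable (r t) in
/-- The form defining the next iterate. -/
def stepForm (x : Fock →L[ℂ] Fock) (A : ℝ → Fock →L[ℂ] Fock) (v u : Fock) : ℂ :=
  ⟪P r lam mu ζp ζm t v, x (P r lam mu ζp ζm t u)⟫_ℂ + ∑ ℓ, ∫ s in (0 : ℝ)..t,
    ⟪applyOrZero (L r lam mu ℓ) (P r lam mu ζp ζm (t - s) v),
      A s (applyOrZero (L r lam mu ℓ) (P r lam mu ζp ζm (t - s) u))⟫_ℂ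

/-- Bounding each pairing by half of `C` times the sum of the squared norms, the total is exactly
what `energy` computes for `v` and for `u`. The constant `C` is therefore reproduced at each
iteration instead of growing. -/
lemma two_mul_norm_stepForm_le {x : Fock →L[ℂ] Fock} (hx : ‖x‖ ≤ C)
    (hA : ∀ s, 0 ≤ s → ‖A s‖ ≤ C) (hM : ∀ j k, Continuous (M j k))
    (hAM : ∀ s, 0 ≤ s → ∀ j k, ⟪e j, A s (e k)⟫_ℂ = M j k s) (ht : 0 ≤ t)
    {v u : Fock} (hv : v ∈ domN 1) (hu : u ∈ domN 1) :
    2 * ‖stepForm r lam mu ζp ζm t x A v u‖ ≤ C * (‖v‖ ^ 2 + ‖u‖ ^ 2) := by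
  obtain ⟨hv2, hv3⟩ := energy hr lam mu ζp ζm ht hv
  obtain ⟨hu2, hu3⟩ := energy hr lam mu ζp ζm ht hu
  set w : Fin 2 → Fock → ℝ → Fock :=
    fun ℓ u s => applyOrZero (L r lam mu ℓ) (P r lam mu ζp ζm (t - s) u) with hw
  have hi : ∀ ℓ, IntervalIntegrable (fun s => ⟪w ℓ v s, A s (w ℓ u s)⟫_ℂ) volume 0 t :=
    intervalIntegrable_inner hr lam mu ζp ζm hA hM hAM ht hv hu
  have h1 : ‖∑ ℓ, ∫ s in (0 : ℝ)..t, ⟪w ℓ v s, A s (w ℓ u s)⟫_ℂ‖ ≤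
      ∫ s in (0 : ℝ)..t, ∑ ℓ, ‖⟪w ℓ v s, A s (w ℓ u s)⟫_ℂ‖ := by
    rw [intervalIntegral.integral_finsetSum fun ℓ _ => (hi ℓ).norm]
    exact (norm_sum_le _ _).trans (Finset.sum_le_sum fun ℓ _ =>
      intervalIntegral.norm_integral_le_integral_norm ht)
  have h2 : ∫ s in (0 : ℝ)..t, ∑ ℓ, ‖⟪w ℓ v s, A s (w ℓ u s)⟫_ℂ‖ ≤
      ∫ s in (0 : ℝ)..t, C / 2 * (∑ ℓ, ‖w ℓ v s‖ ^ 2 + ∑ ℓ, ‖w ℓ u s‖ ^ 2) := by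
    refine intervalIntegral.integral_mono_on ht
      (by simpa using (hi 0).norm.add (hi 1).norm) ((hv2.add hu2).const_mul _) fun s hs => ?_
    rw [← Finset.sum_add_distrib, Finset.mul_sum]
    refine Finset.sum_le_sum fun ℓ _ => ?_
    have := two_mul_norm_inner_le (hA s hs.1) (w ℓ v s) (w ℓ u s)
    linarith
  rw [intervalIntegral.integral_const_mul, intervalIntegral.integral_add hv2 hu2] at h2
  have h3 := two_mul_norm_inner_le hx (P r lam mu ζp ζm t v) (P r lam mu ζp ζm t u)
  rw [stepForm]
  have h4 := norm_add_le ⟪P r lam mu ζp ζm t v, x (P r lam mu ζp ζm t u)⟫_ℂ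
    (∑ ℓ, ∫ s in (0 : ℝ)..t, ⟪w ℓ v s, A s (w ℓ u s)⟫_ℂ)
  rw [← hv3, ← hu3]
  linarith

lemma stepForm_e {x : Fock →L[ℂ] Fock} (hA : ∀ s, 0 ≤ s → ‖A s‖ ≤ C)
    (hM : ∀ j k, Continuous (M j k))
    (hAM : ∀ s, 0 ≤ s → ∀ j k, ⟪e j, A s (e k)⟫_ℂ = M j k s) (ht : 0 ≤ t) (j k : ℕ) :
    stepForm r lam mu ζp ζm t x A (e j) (e k)
      = free r lam mu ζp ζm x j k t + duhamel r lam mu ζp ζm M j k t := by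
  have hi := intervalIntegrable_inner hr lam mu ζp ζm hA hM hAM ht (e_mem_domN 1 j)
    (e_mem_domN 1 k)
  have hexp : ∀ t : ℝ, starRingEnd ℂ (Complex.exp (-(t : ℂ) * rate r lam mu ζp ζm j)) *
      Complex.exp (-(t : ℂ) * rate r lam mu ζp ζm k)
      = Complex.exp (-(t : ℂ) * pairRate r lam mu ζp ζm j k) := fun t => by
    rw [← Complex.exp_conj, ← Complex.exp_add, pairRate]
    congr 1
    simp
    ring
  rw [stepForm, Fin.sum_univ_two, ← intervalIntegral.integral_add (hi 0) (hi 1)]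
  congr 1
  · rw [P_e hr _ _ _ _ ht, P_e hr _ _ _ _ ht, map_smul, inner_smul_left, inner_smul_right,
      ← mul_assoc, hexp, free]
  · refine intervalIntegral.integral_congr fun s hs => ?_
    rw [Set.uIcc_of_le ht] at hs
    have hts := sub_nonneg.2 hs.2
    rw [P_e hr _ _ _ _ hts, P_e hr _ _ _ _ hts, applyOrZero_smul _ _ (e_mem_domN 1 j),
      applyOrZero_smul _ _ (e_mem_domN 1 k), applyOrZero_smul _ _ (e_mem_domN 1 j),
      applyOrZero_smul _ _ (e_mem_domN 1 k), L_zero_e, L_zero_e, L_one_e, L_one_e]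
    simp only [map_smul, inner_smul_left, inner_smul_right, hAM s hs.1]
    rw [← hexp, gain, Complex.conj_ofReal, Complex.conj_ofReal]
    push_cast
    ring

lemma stepForm_spec {x : Fock →L[ℂ] Fock} (hx : ‖x‖ ≤ C)
    (hA : ∀ s, 0 ≤ s → ‖A s‖ ≤ C) (hM : ∀ j k, Continuous (M j k))
    (hAM : ∀ s, 0 ≤ s → ∀ j k, ⟪e j, A s (e k)⟫_ℂ = M j k s) (ht : 0 ≤ t) :
    ‖ofForm (domN 2) (stepForm r lam mu ζp ζm t x A)‖ ≤ C ∧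
    ∀ j k, ⟪e j, ofForm (domN 2) (stepForm r lam mu ζp ζm t x A) (e k)⟫_ℂ
      = free r lam mu ζp ζm x j k t + duhamel r lam mu ζp ζm M j k t := by
  have hD : ∀ {u : Fock}, u ∈ domN 2 → u ∈ domN 1 := fun h => domN_two_le_one h
  have hi := fun v (hv : v ∈ domN 2) u (hu : u ∈ domN 2) =>
    intervalIntegrable_inner hr lam mu ζp ζm hA hM hAM ht (hD hv) (hD hu)
  have hP : ∀ s ∈ Set.uIcc 0 t, ∀ u ∈ domN 2, ∀ ℓ,
      P r lam mu ζp ζm (t - s) u ∈ (L r lam mu ℓ).domain := fun s hs u hu ℓ => by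
    rw [Set.uIcc_of_le ht] at hs
    rw [L_domain]
    exact P_mem_domN hr lam mu ζp ζm (sub_nonneg.2 hs.2) 1 (hD hu)
  have hsl : ∀ (c : ℂ), ∀ v ∈ domN 2, ∀ u ∈ domN 2, stepForm r lam mu ζp ζm t x A (c • v) u
      = starRingEnd ℂ c * stepForm r lam mu ζp ζm t x A v u := fun c v hv u hu => by
    rw [stepForm, stepForm, mul_add, Finset.mul_sum, map_smul, inner_smul_left]
    congr 1
    refine Finset.sum_congr rfl fun ℓ _ => ?_
    rw [← intervalIntegral.integral_const_mul]
    refine intervalIntegral.integral_congr fun s hs => ?_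
    rw [map_smul, applyOrZero_smul _ _ (hP s hs v hv ℓ), inner_smul_left]
  have hsr : ∀ (c : ℂ), ∀ v ∈ domN 2, ∀ u ∈ domN 2, stepForm r lam mu ζp ζm t x A v (c • u)
      = c * stepForm r lam mu ζp ζm t x A v u := fun c v hv u hu => by
    rw [stepForm, stepForm, mul_add, Finset.mul_sum, map_smul, map_smul, inner_smul_right]
    congr 1
    refine Finset.sum_congr rfl fun ℓ _ => ?_
    rw [← intervalIntegral.integral_const_mul]
    refine intervalIntegral.integral_congr fun s hs => ?_
    rw [map_smul, applyOrZero_smul _ _ (hP s hs u hu ℓ), map_smul, inner_smul_right]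
  have hb := form_bound_of_sq hsl hsr fun v hv u hu =>
    two_mul_norm_stepForm_le hr lam mu ζp ζm hx hA hM hAM ht (hD hv) (hD hu)
  have hex := exists_clm_of_form (dense_domN 2) (q := stepForm r lam mu ζp ζm t x A)
    (fun v hv v' hv' u hu => by
      rw [stepForm, stepForm, stepForm, add_add_add_comm, ← Finset.sum_add_distrib, map_add,
        inner_add_left]
      congr 1
      refine Finset.sum_congr rfl fun ℓ _ => ?_
      rw [← intervalIntegral.integral_add (hi v hv u hu ℓ) (hi v' hv' u hu ℓ)]
      refine intervalIntegral.integral_congr fun s hs => ?_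
      rw [map_add, applyOrZero_add _ (hP s hs v hv ℓ) (hP s hs v' hv' ℓ), inner_add_left])
    (fun v hv u hu u' hu' => by
      rw [stepForm, stepForm, stepForm, add_add_add_comm, ← Finset.sum_add_distrib, map_add,
        map_add, inner_add_right]
      congr 1
      refine Finset.sum_congr rfl fun ℓ _ => ?_
      rw [← intervalIntegral.integral_add (hi v hv u hu ℓ) (hi v hv u' hu' ℓ)]
      refine intervalIntegral.integral_congr fun s hs => ?_
      rw [map_add, applyOrZero_add _ (hP s hs u hu ℓ) (hP s hs u' hu' ℓ), map_add,
        inner_add_right])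
    hsl hsr hb
  have hspec := ofForm_spec hex
  refine ⟨norm_le_of_form_bound (dense_domN 2) ((norm_nonneg _).trans hx) fun v hv u hu => ?_,
    fun j k => ?_⟩
  · rw [hspec v hv u hu]
    exact hb v hv u hu
  · rw [hspec _ (e_mem_domN 2 j) _ (e_mem_domN 2 k)]
    exact stepForm_e hr lam mu ζp ζm hA hM hAM ht j k

/-- Both claims must go through one induction: continuity of the entries of one iterate makes the
next integrand measurable, its norm bound makes it integrable, and together they ensure that
`ofForm` does not fall back to `0`. -/
lemma iterate_spec (x : Fock →L[ℂ] Fock) (n : ℕ) : ∀ t : ℝ, 0 ≤ t →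
    ‖iterate (G r lam mu ζp ζm) (P r lam mu ζp ζm) (L r lam mu) n t x‖ ≤ ‖x‖ ∧
    ∀ j k, ⟪e j, iterate (G r lam mu ζp ζm) (P r lam mu ζp ζm) (L r lam mu) n t x (e k)⟫_ℂ
      = entry r lam mu ζp ζm x n j k t := by
  induction n with
  | zero =>
    intro t ht
    have hform : ∀ v u, ⟪v, iterate (G r lam mu ζp ζm) (P r lam mu ζp ζm) (L r lam mu) 0 t x u⟫_ℂ
        = ⟪P r lam mu ζp ζm t v, x (P r lam mu ζp ζm t u)⟫_ℂ := fun v u =>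
      by rw [iterate, ContinuousLinearMap.comp_apply, ContinuousLinearMap.comp_apply,
        ContinuousLinearMap.adjoint_inner_right]
    refine ⟨norm_le_of_form_bound (D := ⊤) (by simp) (norm_nonneg _) fun v _ u _ => ?_,
      fun j k => ?_⟩
    · rw [hform]
      calc _ ≤ ‖P r lam mu ζp ζm t v‖ * (‖x‖ * ‖P r lam mu ζp ζm t u‖) :=
            (norm_inner_le_norm _ _).trans (by gcongr; exact x.le_opNorm _)
        _ ≤ ‖v‖ * (‖x‖ * ‖u‖) := by
            gcongr
            · exact norm_P_le hr lam mu ζp ζm ht v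
            · exact norm_P_le hr lam mu ζp ζm ht u
        _ = _ := by ring
    · rw [hform]
      -- With the zero family in the integrals, the step form reduces to the form of `P_t* x P_t`.
      have := stepForm_e hr lam mu ζp ζm (x := x) (A := 0) (C := 0) (M := 0) (by simp)
        (fun _ _ => continuous_const) (by simp) ht j k
      simpa [stepForm, duhamel, gain, entry] using this
  | succ n ih =>
    intro t ht
    exact stepForm_spec hr lam mu ζp ζm le_rfl (fun s hs => (ih s hs).1)
      (continuous_entry r lam mu ζp ζm x n) (fun s hs => (ih s hs).2) ht

end Step

/-! ### The Dyson series and its domination by the classical process. -/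

/-- The Dyson terms of the backward equation of the birth and death process with birth rates
`λ² ω_{j+1}` and death rates `μ² ω_j`, started from the constant function `1`. -/
def survival (r lam mu : ℝ) : ℕ → ℕ → ℝ → ℝ
  | 0 => fun j t => Real.exp (-t * jumpRate r lam mu j)
  | n + 1 => fun j t => ∫ s in (0 : ℝ)..t, Real.exp (-(t - s) * jumpRate r lam mu j) *
      (mu ^ 2 * omega r j * survival r lam mu n (j - 1) s
        + lam ^ 2 * omega r (j + 1) * survival r lam mu n (j + 1) s)

lemma continuous_survival (r lam mu : ℝ) (n j : ℕ) : Continuous (survival r lam mu n j) := by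
  induction n generalizing j with
  | zero =>
    change Continuous fun t : ℝ => Real.exp (-t * jumpRate r lam mu j)
    fun_prop
  | succ n ih =>
    have h1 := ih (j - 1)
    have h2 := ih (j + 1)
    exact intervalIntegral.continuous_parametric_intervalIntegral_of_continuous
      (f := fun t s => Real.exp (-(t - s) * jumpRate r lam mu j) *
        (mu ^ 2 * omega r j * survival r lam mu n (j - 1) s
          + lam ^ 2 * omega r (j + 1) * survival r lam mu n (j + 1) s))
      (by simp only [Function.uncurry_def]; fun_prop) continuous_id

lemma survival_nonneg {r : ℝ} (hr : 0 < r) (lam mu : ℝ) (n j : ℕ) {t : ℝ} (ht : 0 ≤ t) :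
    0 ≤ survival r lam mu n j t := by
  induction n generalizing j t with
  | zero => exact (Real.exp_pos _).le
  | succ n ih =>
    refine intervalIntegral.integral_nonneg ht fun s hs => ?_
    have h1 := ih (j - 1) hs.1
    have h2 := ih (j + 1) hs.1
    have h3 := omega_nonneg hr j
    have h4 := omega_nonneg hr (j + 1)
    positivity

lemma integral_exp_mul_rate (q t : ℝ) :
    ∫ s in (0 : ℝ)..t, Real.exp (-(t - s) * q) * q = 1 - Real.exp (-t * q) := by
  have hd : ∀ s ∈ Set.uIcc 0 t,
      HasDerivAt (fun s => Real.exp (-(t - s) * q)) (Real.exp (-(t - s) * q) * q) s := fun s _ => by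
    have h4 : HasDerivAt (fun s : ℝ => -(t - s) * q) q s := by
      simpa using (((hasDerivAt_id s).const_sub t).neg.mul_const q)
    exact h4.exp
  rw [intervalIntegral.integral_eq_sub_of_hasDerivAt hd
    (Continuous.intervalIntegrable (by fun_prop) _ _)]
  simp

/-- The `n`-th term is the probability of exactly `n` jumps up to time `t` when starting from `j`.
In the induction, after the first jump the remaining terms sum to at most `1`, so terms `1` to `N`
contribute at most the probability `1 - exp(-t q_j)` of having jumped, where `q_j` is the total jump
rate; the zeroth term is the complement. -/
lemma sum_survival_le_one {r : ℝ} (hr : 0 < r) (lam mu : ℝ) (N j : ℕ) {t : ℝ} (ht : 0 ≤ t) :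
    ∑ n ∈ Finset.range N, survival r lam mu n j t ≤ 1 := by
  induction N generalizing j t with
  | zero => simp
  | succ N ih =>
    have hc := continuous_survival r lam mu
    rw [Finset.sum_range_succ']
    have h1 : ∑ n ∈ Finset.range N, survival r lam mu (n + 1) j t
        = ∫ s in (0 : ℝ)..t, Real.exp (-(t - s) * jumpRate r lam mu j) *
          (mu ^ 2 * omega r j * ∑ n ∈ Finset.range N, survival r lam mu n (j - 1) s
          + lam ^ 2 * omega r (j + 1) * ∑ n ∈ Finset.range N, survival r lam mu n (j + 1) s) := by
      simp only [survival]
      rw [← intervalIntegral.integral_finsetSum fun n _ => ?_]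
      · refine intervalIntegral.integral_congr fun s _ => ?_
        simp only [Finset.mul_sum, ← Finset.sum_add_distrib]
      · have h1 := hc n (j - 1)
        have h2 := hc n (j + 1)
        exact Continuous.intervalIntegrable (by fun_prop) _ _
    have h2 : ∑ n ∈ Finset.range N, survival r lam mu (n + 1) j t ≤
        ∫ s in (0 : ℝ)..t, Real.exp (-(t - s) * jumpRate r lam mu j) * jumpRate r lam mu j := by
      rw [h1]
      refine intervalIntegral.integral_mono_on ht
        (Continuous.intervalIntegrable (by fun_prop) _ _)
        (Continuous.intervalIntegrable (by fun_prop) _ _) fun s hs => ?_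
      have h3 := mul_le_mul_of_nonneg_left (ih (j - 1) hs.1)
        (mul_nonneg (sq_nonneg mu) (omega_nonneg hr j))
      have h4 := mul_le_mul_of_nonneg_left (ih (j + 1) hs.1)
        (mul_nonneg (sq_nonneg lam) (omega_nonneg hr (j + 1)))
      refine mul_le_mul_of_nonneg_left ?_ (Real.exp_pos _).le
      rw [jumpRate]
      linarith
    rw [integral_exp_mul_rate] at h2
    have h3 : survival r lam mu 0 j t = Real.exp (-t * jumpRate r lam mu j) := rfl
    linarith

lemma summable_survival {r : ℝ} (hr : 0 < r) (lam mu : ℝ) (j : ℕ) {t : ℝ} (ht : 0 ≤ t) :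
    Summable fun n => survival r lam mu n j t :=
  summable_of_sum_range_le (fun n => survival_nonneg hr lam mu n j ht)
    fun N => sum_survival_le_one hr lam mu N j ht

/-- The matrices of the Dyson terms, the differences of consecutive iterates. -/
def dyson (r lam mu ζp ζm : ℝ) (x : Fock →L[ℂ] Fock) : ℕ → ℕ → ℕ → ℝ → ℂ
  | 0 => free r lam mu ζp ζm x
  | n + 1 => duhamel r lam mu ζp ζm (dyson r lam mu ζp ζm x n)

lemma continuous_dyson (r lam mu ζp ζm : ℝ) (x : Fock →L[ℂ] Fock) (n j k : ℕ) :
    Continuous (dyson r lam mu ζp ζm x n j k) := by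
  induction n generalizing j k with
  | zero => exact continuous_free r lam mu ζp ζm x j k
  | succ n ih => exact continuous_duhamel r lam mu ζp ζm ih j k

lemma duhamel_sum (r lam mu ζp ζm : ℝ) {f : ℕ → ℕ → ℕ → ℝ → ℂ}
    (hf : ∀ n j k, Continuous (f n j k)) (N j k : ℕ) (t : ℝ) :
    duhamel r lam mu ζp ζm (fun j k t => ∑ n ∈ Finset.range N, f n j k t) j k t
      = ∑ n ∈ Finset.range N, duhamel r lam mu ζp ζm (f n) j k t := by
  simp only [duhamel]
  rw [← intervalIntegral.integral_finsetSum fun n _ => ?_]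
  · refine intervalIntegral.integral_congr fun s _ => ?_
    simp only [gain, Finset.mul_sum, ← Finset.sum_add_distrib]
  · have := continuous_gain r lam mu (hf n) j k
    exact Continuous.intervalIntegrable (by fun_prop) _ _

lemma entry_eq_sum_dyson (r lam mu ζp ζm : ℝ) (x : Fock →L[ℂ] Fock) (n j k : ℕ) (t : ℝ) :
    entry r lam mu ζp ζm x n j k t
      = ∑ m ∈ Finset.range (n + 1), dyson r lam mu ζp ζm x m j k t := by
  induction n generalizing j k t with
  | zero => simp [entry, dyson]
  | succ n ih =>
    have h : entry r lam mu ζp ζm x n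
        = fun j k t => ∑ m ∈ Finset.range (n + 1), dyson r lam mu ζp ζm x m j k t := by
      funext j k t
      exact ih j k t
    have h1 := duhamel_sum r lam mu ζp ζm (continuous_dyson r lam mu ζp ζm x) (n + 1) j k t
    rw [← h] at h1
    refine Eq.trans ?_ ((Finset.sum_range_succ' _ _).trans (add_comm _ _)).symm
    exact congrArg (free r lam mu ζp ζm x j k t + ·) h1

/-- The hypothesis for all `c > 0` is `D ≤ K √(X Y)` without the roots. In this form the bound is
stable under multiplication by `α β`, and for fixed `c` it is linear in `X` and `Y`, so it can be
integrated in time. -/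
lemma two_mul_le_weighted {α β D X Y K : ℝ} (hα : 0 ≤ α) (hβ : 0 ≤ β) (hX : 0 ≤ X) (hY : 0 ≤ Y)
    (hK : 0 ≤ K) (h : ∀ c : ℝ, 0 < c → 2 * D ≤ K * (c * X + c⁻¹ * Y)) {c : ℝ} (hc : 0 < c) :
    2 * (α * β * D) ≤ K * (c * (α ^ 2 * X) + c⁻¹ * (β ^ 2 * Y)) := by
  rcases hα.eq_or_lt with rfl | hα
  · simp
    positivity
  rcases hβ.eq_or_lt with rfl | hβ
  · simp
    positivity
  -- The weight `c α / β` turns `α β` into `c α²` on `X` and into `c⁻¹ β²` on `Y`.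
  have h1 := mul_le_mul_of_nonneg_left (h (c * α / β) (by positivity)) (mul_pos hα hβ).le
  calc _ = α * β * (2 * D) := by ring
    _ ≤ _ := h1
    _ = _ := by field_simp

lemma norm_exp_mul_pairRate (r lam mu ζp ζm t : ℝ) (j k : ℕ) :
    ‖Complex.exp (-(t : ℂ) * pairRate r lam mu ζp ζm j k)‖
      = Real.exp (-t * jumpRate r lam mu j / 2) * Real.exp (-t * jumpRate r lam mu k / 2) := by
  rw [Complex.norm_exp, ← Real.exp_add]
  simp [pairRate_re]
  ring

lemma exp_half_sq (y : ℝ) : Real.exp (y / 2) ^ 2 = Real.exp y := by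
  rw [← Real.exp_nat_mul]
  congr 1
  push_cast
  ring

lemma norm_entry_le (x : Fock →L[ℂ] Fock) (j k : ℕ) : ‖⟪e j, x (e k)⟫_ℂ‖ ≤ ‖x‖ := by
  calc _ ≤ ‖e j‖ * (‖x‖ * ‖e k‖) := (norm_inner_le_norm _ _).trans (by gcongr; exact x.le_opNorm _)
    _ = _ := by simp [norm_e]

/-- The off-diagonal Dyson terms are dominated by the diagonal ones. -/
lemma two_mul_norm_dyson_le {r : ℝ} (hr : 0 < r) (lam mu ζp ζm : ℝ) (x : Fock →L[ℂ] Fock)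
    (n j k : ℕ) {t : ℝ} (ht : 0 ≤ t) {c : ℝ} (hc : 0 < c) :
    2 * ‖dyson r lam mu ζp ζm x n j k t‖
      ≤ ‖x‖ * (c * survival r lam mu n j t + c⁻¹ * survival r lam mu n k t) := by
  induction n generalizing j k t c with
  | zero =>
    rw [dyson, free, norm_mul, norm_exp_mul_pairRate]
    simp only [survival]
    have h1 := two_mul_le_weighted (K := ‖x‖) (D := ‖⟪e j, x (e k)⟫_ℂ‖) (X := 1) (Y := 1)
      (Real.exp_pos (-t * jumpRate r lam mu j / 2)).le
      (Real.exp_pos (-t * jumpRate r lam mu k / 2)).le zero_le_one zero_le_one (norm_nonneg x)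
      (fun c hc => by
        have h2 : 2 ≤ c * 1 + c⁻¹ * 1 := by
          have h3 : c * c⁻¹ = 1 := mul_inv_cancel₀ hc.ne'
          have h4 : 0 < c⁻¹ := inv_pos.2 hc
          nlinarith [sq_nonneg (c - c⁻¹)]
        nlinarith [norm_entry_le x j k, norm_nonneg x]) hc
    rw [exp_half_sq, exp_half_sq] at h1
    simpa using h1
  | succ n ih =>
    have hcs := continuous_survival r lam mu n
    have hg := continuous_gain r lam mu (continuous_dyson r lam mu ζp ζm x n) j k
    have hb : ‖dyson r lam mu ζp ζm x (n + 1) j k t‖ ≤ ∫ s in (0 : ℝ)..t,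
        ‖Complex.exp (-((t - s : ℝ) : ℂ) * pairRate r lam mu ζp ζm j k)
          * gain r lam mu (dyson r lam mu ζp ζm x n) j k s‖ :=
      intervalIntegral.norm_integral_le_integral_norm ht
    set S : ℕ → ℝ → ℝ := fun j s => Real.exp (-(t - s) * jumpRate r lam mu j) *
      (mu ^ 2 * omega r j * survival r lam mu n (j - 1) s
        + lam ^ 2 * omega r (j + 1) * survival r lam mu n (j + 1) s) with hS
    have hSc : ∀ j, Continuous (S j) := fun j => by fun_prop
    have h1 : ∫ s in (0 : ℝ)..t, ‖Complex.exp (-((t - s : ℝ) : ℂ) * pairRate r lam mu ζp ζm j k)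
          * gain r lam mu (dyson r lam mu ζp ζm x n) j k s‖
        ≤ ∫ s in (0 : ℝ)..t, ‖x‖ / 2 * (c * S j s + c⁻¹ * S k s) := by
      refine intervalIntegral.integral_mono_on ht
        (Continuous.intervalIntegrable (by fun_prop) _ _)
        (Continuous.intervalIntegrable (by fun_prop) _ _) fun s hs => ?_
      have hsn : ∀ i, 0 ≤ survival r lam mu n i s := fun i => survival_nonneg hr lam mu n i hs.1
      have hw : ∀ (b : ℝ) (i i' j' k' : ℕ),
          2 * (Real.exp (-(t - s) * jumpRate r lam mu j / 2) *
            Real.exp (-(t - s) * jumpRate r lam mu k / 2) *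
            (b ^ 2 * Real.sqrt (omega r i) * Real.sqrt (omega r i')
              * ‖dyson r lam mu ζp ζm x n j' k' s‖)) ≤
          ‖x‖ * (c * (Real.exp (-(t - s) * jumpRate r lam mu j) *
              (b ^ 2 * omega r i * survival r lam mu n j' s))
            + c⁻¹ * (Real.exp (-(t - s) * jumpRate r lam mu k) *
              (b ^ 2 * omega r i' * survival r lam mu n k' s))) := fun b i i' j' k' => by
        -- The off-diagonal coefficient is a product of square roots of the two diagonal ones; `α`
        -- and `β` are these roots, exponential included, and their squares restore the integrands
        -- of `survival`.
        have h2 := two_mul_le_weighted (K := ‖x‖)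
          (α := Real.exp (-(t - s) * jumpRate r lam mu j / 2) * (|b| * Real.sqrt (omega r i)))
          (β := Real.exp (-(t - s) * jumpRate r lam mu k / 2) * (|b| * Real.sqrt (omega r i')))
          (by positivity) (by positivity) (hsn j') (hsn k') (norm_nonneg x)
          (fun c hc => ih j' k' hs.1 hc) hc
        simp only [mul_pow, exp_half_sq, sq_abs, Real.sq_sqrt (omega_nonneg hr _)] at h2
        rw [← sq_abs b] at h2 ⊢
        linarith
      have hgn : ‖gain r lam mu (dyson r lam mu ζp ζm x n) j k s‖ ≤
          mu ^ 2 * Real.sqrt (omega r j) * Real.sqrt (omega r k)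
            * ‖dyson r lam mu ζp ζm x n (j - 1) (k - 1) s‖ +
          lam ^ 2 * Real.sqrt (omega r (j + 1)) * Real.sqrt (omega r (k + 1))
            * ‖dyson r lam mu ζp ζm x n (j + 1) (k + 1) s‖ := by
        refine (norm_add_le _ _).trans_eq ?_
        rw [norm_mul, norm_mul, Complex.norm_real, Complex.norm_real,
          Real.norm_of_nonneg (by positivity), Real.norm_of_nonneg (by positivity)]
      rw [norm_mul, norm_exp_mul_pairRate]
      have h3 := mul_le_mul_of_nonneg_left hgn
        (mul_pos (Real.exp_pos (-(t - s) * jumpRate r lam mu j / 2))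
          (Real.exp_pos (-(t - s) * jumpRate r lam mu k / 2))).le
      have h4 := hw mu j k (j - 1) (k - 1)
      have h5 := hw lam (j + 1) (k + 1) (j + 1) (k + 1)
      simp only [hS]
      linarith
    rw [intervalIntegral.integral_const_mul, intervalIntegral.integral_add
      (((hSc j).intervalIntegrable _ _).const_mul _) (((hSc k).intervalIntegrable _ _).const_mul _),
      intervalIntegral.integral_const_mul, intervalIntegral.integral_const_mul] at h1
    change _ ≤ ‖x‖ * (c * (∫ s in (0 : ℝ)..t, S j s) + c⁻¹ * ∫ s in (0 : ℝ)..t, S k s)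
    linarith

lemma cauchySeq_entry {r : ℝ} (hr : 0 < r) (lam mu ζp ζm : ℝ) (x : Fock →L[ℂ] Fock)
    (j k : ℕ) {t : ℝ} (ht : 0 ≤ t) : CauchySeq fun n => entry r lam mu ζp ζm x n j k t := by
  have hs : Summable fun n => dyson r lam mu ζp ζm x n j k t := by
    refine Summable.of_norm_bounded (((summable_survival hr lam mu j ht).add
      (summable_survival hr lam mu k ht)).mul_left (‖x‖ / 2)) fun n => ?_
    have := two_mul_norm_dyson_le hr lam mu ζp ζm x n j k ht one_pos
    rw [inv_one, one_mul, one_mul] at this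
    linarith
  simp only [entry_eq_sum_dyson]
  exact (hs.hasSum.tendsto_sum_nat.comp (tendsto_add_atTop_nat 1)).cauchySeq

/-- Convergence of the entries extends by sesquilinearity to the span of the basis, and by the
uniform norm bound to all vectors; hence `weakLimit` is the true limit. -/
lemma tendsto_entry {r : ℝ} (hr : 0 < r) (lam mu ζp ζm : ℝ) (x : Fock →L[ℂ] Fock)
    {t : ℝ} (ht : 0 ≤ t) (j k : ℕ) : Tendsto (fun n => entry r lam mu ζp ζm x n j k t) atTop
      (𝓝 ⟪e j, semigroup r lam mu ζp ζm t x (e k)⟫_ℂ) := by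
  have hspec := fun n => iterate_spec hr lam mu ζp ζm x n t ht
  set A : ℕ → Fock →L[ℂ] Fock :=
    fun n => iterate (G r lam mu ζp ζm) (P r lam mu ζp ζm) (L r lam mu) n t x
  have h1 : ∀ j, ∀ u ∈ Submodule.span ℂ (Set.range e), CauchySeq fun n => ⟪e j, A n u⟫_ℂ := by
    intro j u hu
    induction hu using Submodule.span_induction with
    | mem u hu =>
      obtain ⟨k, rfl⟩ := hu
      simpa only [A, (hspec _).2] using cauchySeq_entry hr lam mu ζp ζm x j k ht
    | zero => simpa using cauchySeq_const (0 : ℂ)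
    | add u v _ _ hu hv =>
      simp only [map_add, inner_add_right]
      exact hu.add hv
    | smul c u _ hu =>
      simp only [map_smul, inner_smul_right]
      exact (uniformContinuous_const_smul c).comp_cauchySeq hu
  have h2 : ∀ v ∈ Submodule.span ℂ (Set.range e), ∀ u ∈ Submodule.span ℂ (Set.range e),
      CauchySeq fun n => ⟪v, A n u⟫_ℂ := by
    intro v hv u hu
    induction hv using Submodule.span_induction with
    | mem v hv =>
      obtain ⟨j, rfl⟩ := hv
      exact h1 j u hu
    | zero => simpa using cauchySeq_const (0 : ℂ)
    | add v w _ _ hv hw =>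
      simp only [inner_add_left]
      exact hv.add hw
    | smul c v _ hv =>
      simp only [inner_smul_left]
      exact (uniformContinuous_const_smul (starRingEnd ℂ c)).comp_cauchySeq hv
  have h3 := weakLimit_spec (exists_weakLimit dense_span_e (fun n => (hspec n).1) h2) (e j) (e k)
  exact h3.congr fun n => (hspec n).2 j k

lemma norm_entry_apply_le {r : ℝ} (hr : 0 < r) (lam mu ζp ζm : ℝ) (x : Fock →L[ℂ] Fock)
    {t : ℝ} (ht : 0 ≤ t) (n j k : ℕ) : ‖entry r lam mu ζp ζm x n j k t‖ ≤ ‖x‖ := by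
  rw [← (iterate_spec hr lam mu ζp ζm x n t ht).2]
  exact (norm_entry_le _ j k).trans (iterate_spec hr lam mu ζp ζm x n t ht).1

/-! ### The diagonal evolution and detailed balance. -/

lemma pairRate_self (r lam mu ζp ζm : ℝ) (j : ℕ) :
    pairRate r lam mu ζp ζm j j = (jumpRate r lam mu j : ℂ) := by
  rw [pairRate, add_comm, Complex.add_conj, rate_re]
  push_cast
  ring

lemma gain_self {r : ℝ} (hr : 0 < r) (lam mu : ℝ) (f : ℕ → ℕ → ℝ → ℂ) (j : ℕ) (s : ℝ) :
    gain r lam mu f j j s = ((mu ^ 2 * omega r j : ℝ) : ℂ) * f (j - 1) (j - 1) s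
      + ((lam ^ 2 * omega r (j + 1) : ℝ) : ℂ) * f (j + 1) (j + 1) s := by
  rw [gain, mul_assoc (mu ^ 2), mul_assoc (lam ^ 2), Real.mul_self_sqrt (omega_nonneg hr _),
    Real.mul_self_sqrt (omega_nonneg hr _)]

/-- The generator of the birth and death process on the diagonal. -/
def diagGen (r lam mu : ℝ) (g m : ℕ → ℂ) (j : ℕ) : ℂ :=
  -(jumpRate r lam mu j : ℂ) * g j + (((mu ^ 2 * omega r j : ℝ) : ℂ) * m (j - 1)
    + ((lam ^ 2 * omega r (j + 1) : ℝ) : ℂ) * m (j + 1))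

/-- The geometric weights are in detailed balance with the jump rates, so that the weighted sum of
the generator reduces to a boundary term. -/
lemma sum_diagGen (r : ℝ) {lam mu : ℝ} (hmu : mu ≠ 0) (m : ℕ → ℂ) (J : ℕ) :
    ∑ j ∈ Finset.range J, (((lam / mu) ^ (2 * j) : ℝ) : ℂ) * diagGen r lam mu m m j
      = ((mu ^ 2 * ((lam / mu) ^ (2 * J) * omega r J) : ℝ) : ℂ) * (m J - m (J - 1)) := by
  induction J with
  | zero => simp [omega_zero]
  | succ J ih =>
    -- Detailed balance between the states `J` and `J + 1`, with the common factor `ω_{J+1}`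
    -- removed.
    have h : (((lam / mu) ^ (2 * (J + 1)) : ℝ) : ℂ) * (mu : ℂ) ^ 2
        = (((lam / mu) ^ (2 * J) : ℝ) : ℂ) * (lam : ℂ) ^ 2 := by
      norm_cast
      rw [mul_add, pow_add, mul_assoc, mul_one, div_pow lam mu 2,
        div_mul_cancel₀ _ (pow_ne_zero 2 hmu)]
    rw [Finset.sum_range_succ, ih, diagGen, jumpRate, Nat.add_sub_cancel]
    generalize (lam / mu) ^ (2 * (J + 1)) = a at h ⊢
    generalize (lam / mu) ^ (2 * J) = b at h ⊢
    push_cast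
    linear_combination (-(omega r (J + 1) : ℂ) * (m (J + 1) - m J)) * h

/-- On the diagonal the phases from `ζ⁺` and `ζ⁻` cancel. The loss involves the new iterate and the
gain the previous one, which is why `diagGen` takes two sequences; they merge only as `n → ∞`. -/
lemma entry_succ_diag {r : ℝ} (hr : 0 < r) (lam mu ζp ζm : ℝ) (x : Fock →L[ℂ] Fock) (n j : ℕ)
    (t : ℝ) : ∫ s in (0 : ℝ)..t, diagGen r lam mu
        (fun i => entry r lam mu ζp ζm x (n + 1) i i s) (fun i => entry r lam mu ζp ζm x n i i s) j
      = entry r lam mu ζp ζm x (n + 1) j j t - ⟪e j, x (e j)⟫_ℂ := by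
  have hc := continuous_entry r lam mu ζp ζm x
  have hd : ∀ s ∈ Set.uIcc 0 t, HasDerivAt (entry r lam mu ζp ζm x (n + 1) j j)
      (diagGen r lam mu (fun i => entry r lam mu ζp ζm x (n + 1) i i s)
        (fun i => entry r lam mu ζp ζm x n i i s) j) s := fun s _ => by
    refine ((hasDerivAt_free r lam mu ζp ζm x j j s).add
      (hasDerivAt_duhamel r lam mu ζp ζm (hc n) j j s)).congr_deriv ?_
    rw [gain_self hr, pairRate_self, diagGen, entry]
    ring
  have hi : Continuous fun s => diagGen r lam mu
      (fun i => entry r lam mu ζp ζm x (n + 1) i i s)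
      (fun i => entry r lam mu ζp ζm x n i i s) j := by
    have h1 := hc (n + 1) j j
    have h2 := hc n (j - 1) (j - 1)
    have h3 := hc n (j + 1) (j + 1)
    unfold diagGen
    fun_prop
  rw [intervalIntegral.integral_eq_sub_of_hasDerivAt hd (hi.intervalIntegrable _ _)]
  congr 1
  simp [entry, free, duhamel]

lemma tendsto_pow_mul_omega (r : ℝ) {ν : ℝ} (h0 : 0 ≤ ν) (h1 : ν < 1) :
    Tendsto (fun J : ℕ => ν ^ (2 * J) * omega r J) atTop (𝓝 0) := by
  have h2 : |ν ^ 2| < 1 := by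
    rw [abs_of_nonneg (by positivity)]
    exact pow_lt_one₀ h0 h1 two_ne_zero
  have h3 := tendsto_pow_const_mul_const_pow_of_abs_lt_one 2 h2
  have h4 := (tendsto_pow_const_mul_const_pow_of_abs_lt_one 1 h2).const_mul (r - 1)
  have h5 := h3.add h4
  rw [mul_zero, add_zero] at h5
  refine h5.congr fun J => ?_
  rw [omega, pow_mul]
  ring

/-! ### Passage to the limit and vanishing of the boundary flux. -/

section Invariance

variable {r lam mu : ℝ} (hr : 0 < r) (hlam : 0 < lam) (hmu : 0 < mu) (hν : lam / mu < 1)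
  (ζp ζm : ℝ) (x : Fock →L[ℂ] Fock) {t : ℝ} (ht : 0 ≤ t)

include hr hlam hmu ht

/-- The limit of `∫₀ᵗ F n` is evaluated twice: integrating each generator term in time gives the
weighted increments, while passing to the limit under the integral gives the telescoped flux,
bounded through `|m_J - m_{J-1}| ≤ 2 ‖x‖`. -/
lemma norm_sum_diag_sub_le (J : ℕ) :
    ‖∑ j ∈ Finset.range J, (((lam / mu) ^ (2 * j) : ℝ) : ℂ) *
      (⟪e j, semigroup r lam mu ζp ζm t x (e j)⟫_ℂ - ⟪e j, x (e j)⟫_ℂ)‖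
    ≤ mu ^ 2 * ((lam / mu) ^ (2 * J) * omega r J) * (2 * ‖x‖) * t := by
  have hc := continuous_entry r lam mu ζp ζm x
  have hlim := fun (s : ℝ) (hs : 0 ≤ s) => tendsto_entry hr lam mu ζp ζm x hs
  set m : ℝ → ℕ → ℂ := fun s j => ⟪e j, semigroup r lam mu ζp ζm s x (e j)⟫_ℂ with hm
  have hmb : ∀ s, 0 ≤ s → ∀ j, ‖m s j‖ ≤ ‖x‖ := fun s hs j =>
    le_of_tendsto (hlim s hs j j).norm
      (Eventually.of_forall fun n => norm_entry_apply_le hr lam mu ζp ζm x hs n j j)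
  set F : ℕ → ℝ → ℂ := fun n s => ∑ j ∈ Finset.range J, (((lam / mu) ^ (2 * j) : ℝ) : ℂ) *
    diagGen r lam mu (fun i => entry r lam mu ζp ζm x (n + 1) i i s)
      (fun i => entry r lam mu ζp ζm x n i i s) j with hF
  have hdc : ∀ n j, Continuous fun s => (((lam / mu) ^ (2 * j) : ℝ) : ℂ) *
      diagGen r lam mu (fun i => entry r lam mu ζp ζm x (n + 1) i i s)
        (fun i => entry r lam mu ζp ζm x n i i s) j := fun n j => by
    have h1 := hc (n + 1) j j
    have h2 := hc n (j - 1) (j - 1)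
    have h3 := hc n (j + 1) (j + 1)
    unfold diagGen
    fun_prop
  have hFint : ∀ n, ∫ s in (0 : ℝ)..t, F n s = ∑ j ∈ Finset.range J,
      (((lam / mu) ^ (2 * j) : ℝ) : ℂ) *
        (entry r lam mu ζp ζm x (n + 1) j j t - ⟪e j, x (e j)⟫_ℂ) := fun n => by
    rw [hF, intervalIntegral.integral_finsetSum fun j _ => (hdc n j).intervalIntegrable _ _]
    refine Finset.sum_congr rfl fun j _ => ?_
    rw [intervalIntegral.integral_const_mul, entry_succ_diag hr]
  have hlhs : Tendsto (fun n => ∫ s in (0 : ℝ)..t, F n s) atTop (𝓝 (∑ j ∈ Finset.range J,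
      (((lam / mu) ^ (2 * j) : ℝ) : ℂ) * (m t j - ⟪e j, x (e j)⟫_ℂ))) := by
    simp only [hFint]
    exact tendsto_finsetSum _ fun j _ =>
      (((hlim t ht j j).comp (tendsto_add_atTop_nat 1)).sub_const _).const_mul _
  have hrhs : Tendsto (fun n => ∫ s in (0 : ℝ)..t, F n s) atTop
      (𝓝 (∫ s in (0 : ℝ)..t, ((mu ^ 2 * ((lam / mu) ^ (2 * J) * omega r J) : ℝ) : ℂ)
        * (m s J - m s (J - 1)))) := by
    -- For fixed `J` the sum is finite and every entry is at most `‖x‖`, so a constant dominates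
    -- uniformly in `n` and `s`.
    refine intervalIntegral.tendsto_integral_filter_of_dominated_convergence
      (fun _ => ∑ j ∈ Finset.range J, (lam / mu) ^ (2 * j) * (jumpRate r lam mu j * ‖x‖
        + (mu ^ 2 * omega r j * ‖x‖ + lam ^ 2 * omega r (j + 1) * ‖x‖))) ?_ ?_ ?_ ?_
    · exact Eventually.of_forall fun n =>
        (continuous_finsetSum _ fun j _ => hdc n j).aestronglyMeasurable
    · refine Eventually.of_forall fun n => Eventually.of_forall fun s hs => ?_
      rw [Set.uIoc_of_le ht] at hs
      refine (norm_sum_le _ _).trans (Finset.sum_le_sum fun j _ => ?_)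
      have hb := norm_entry_apply_le hr lam mu ζp ζm x hs.1.le
      have h1 := omega_nonneg hr j
      have h2 := omega_nonneg hr (j + 1)
      have h3 := jumpRate_nonneg hr lam mu j
      rw [norm_mul, Complex.norm_real, Real.norm_of_nonneg (by positivity)]
      refine mul_le_mul_of_nonneg_left ?_ (by positivity)
      refine (norm_add_le _ _).trans (add_le_add ?_ ((norm_add_le _ _).trans (add_le_add ?_ ?_)))
      · rw [norm_mul, norm_neg, Complex.norm_real, Real.norm_of_nonneg h3]
        exact mul_le_mul_of_nonneg_left (hb _ _ _) h3
      · rw [norm_mul, Complex.norm_real, Real.norm_of_nonneg (by positivity)]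
        exact mul_le_mul_of_nonneg_left (hb _ _ _) (by positivity)
      · rw [norm_mul, Complex.norm_real, Real.norm_of_nonneg (by positivity)]
        exact mul_le_mul_of_nonneg_left (hb _ _ _) (by positivity)
    · exact intervalIntegrable_const
    · refine Eventually.of_forall fun s hs => ?_
      rw [Set.uIoc_of_le ht] at hs
      rw [← sum_diagGen r hmu.ne' (m s) J]
      refine tendsto_finsetSum _ fun j _ => Tendsto.const_mul _ ?_
      have h := hlim s hs.1.le
      exact (((h j j).comp (tendsto_add_atTop_nat 1)).const_mul _).add
        (((h (j - 1) (j - 1)).const_mul _).add ((h (j + 1) (j + 1)).const_mul _))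
  have heq := tendsto_nhds_unique hlhs hrhs
  change ‖∑ j ∈ Finset.range J,
      (((lam / mu) ^ (2 * j) : ℝ) : ℂ) * (m t j - ⟪e j, x (e j)⟫_ℂ)‖ ≤ _
  rw [heq]
  have hcoef : 0 ≤ mu ^ 2 * ((lam / mu) ^ (2 * J) * omega r J) := by
    have := omega_nonneg hr J
    positivity
  refine (intervalIntegral.norm_integral_le_of_norm_le_const (C :=
    mu ^ 2 * ((lam / mu) ^ (2 * J) * omega r J) * (2 * ‖x‖)) fun s hs => ?_).trans_eq ?_
  · rw [Set.uIoc_of_le ht] at hs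
    rw [norm_mul, Complex.norm_real, Real.norm_of_nonneg hcoef]
    refine mul_le_mul_of_nonneg_left ?_ hcoef
    have := norm_sub_le (m s J) (m s (J - 1))
    linarith [hmb s hs.1.le J, hmb s hs.1.le (J - 1)]
  · rw [sub_zero, abs_of_nonneg ht]

include hν

lemma tsum_diag_semigroup :
    ∑' j, (((lam / mu) ^ (2 * j) : ℝ) : ℂ) * ⟪e j, semigroup r lam mu ζp ζm t x (e j)⟫_ℂ
      = ∑' j, (((lam / mu) ^ (2 * j) : ℝ) : ℂ) * ⟪e j, x (e j)⟫_ℂ := by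
  have h0 : 0 ≤ lam / mu := by positivity
  have hs : ∀ y : Fock →L[ℂ] Fock,
      Summable fun j => (((lam / mu) ^ (2 * j) : ℝ) : ℂ) * ⟪e j, y (e j)⟫_ℂ := fun y => by
    have hg : Summable fun j : ℕ => (lam / mu) ^ (2 * j) := by
      simp only [pow_mul]
      exact summable_geometric_of_lt_one (by positivity) (pow_lt_one₀ h0 hν two_ne_zero)
    refine Summable.of_norm_bounded (hg.mul_right ‖y‖) fun j => ?_
    rw [norm_mul, Complex.norm_real, Real.norm_of_nonneg (by positivity)]
    exact mul_le_mul_of_nonneg_left (norm_entry_le y j j) (by positivity)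
  rw [← sub_eq_zero, ← (hs _).tsum_sub (hs _)]
  have h1 := ((hs (semigroup r lam mu ζp ζm t x)).sub (hs x)).hasSum.tendsto_sum_nat
  -- The partial sums of the difference series also tend to `0`, as they are controlled by the flux
  -- through level `J`.
  refine tendsto_nhds_unique h1 ?_
  have h2 : Tendsto (fun J : ℕ => mu ^ 2 * ((lam / mu) ^ (2 * J) * omega r J) * (2 * ‖x‖) * t)
      atTop (𝓝 0) := by
    simpa using ((((tendsto_pow_mul_omega r h0 hν).const_mul (mu ^ 2)).mul_const
      (2 * ‖x‖)).mul_const t)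
  refine squeeze_zero_norm (fun J => ?_) h2
  simp only [← mul_sub]
  exact norm_sum_diag_sub_le hr hlam hmu ζp ζm x ht J

end Invariance

/-! ### The geometric state as a diagonal density operator. -/

section GeometricState

variable {ν : ℝ} (h0 : 0 ≤ ν) (h1 : ν < 1)

include h0 h1

/-- The projections have norm one, so the defining series converges absolutely in operator norm and
can be evaluated coordinate by coordinate. -/
lemma geometricState_apply (u : Fock) (n : ℕ) :
    geometricState ν u n = (((1 - ν ^ 2) * ν ^ (2 * n) : ℝ) : ℂ) * u n := by
  have hs : Summable fun m : ℕ =>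
      (ν : ℂ) ^ (2 * m) • InnerProductSpace.rankOne ℂ (e m) (e m) := by
    have hg : Summable fun j : ℕ => ν ^ (2 * j) := by
      simp only [pow_mul]
      exact summable_geometric_of_lt_one (by positivity) (pow_lt_one₀ h0 h1 two_ne_zero)
    refine Summable.of_norm_bounded hg fun m => ?_
    rw [norm_smul, InnerProductSpace.norm_rankOne, norm_e, norm_pow, Complex.norm_real,
      Real.norm_of_nonneg h0]
    simp
  rw [geometricState]
  obtain ⟨T, hT⟩ := hs
  rw [hT.tsum_eq]
  have h2 : HasSum (fun m : ℕ => if m = n then (ν : ℂ) ^ (2 * n) * u n else 0) ⟪e n, T u⟫_ℂ := by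
    refine ((innerSL ℂ (e n)).hasSum
      ((ContinuousLinearMap.apply ℂ Fock u).hasSum hT)).congr_fun fun m => ?_
    rw [ContinuousLinearMap.apply_apply, smul_apply,
      InnerProductSpace.rankOne_apply, innerSL_apply_apply, inner_smul_right, inner_smul_right,
      inner_e, inner_e, e_apply]
    by_cases h : m = n
    · simp [h]
    · simp [h, Ne.symm h]
  rw [← inner_e n, smul_apply, inner_smul_right, h2.unique (hasSum_ite_eq n _)]
  push_cast
  ring

lemma isDensityOperator_geometricState : IsDensityOperator (geometricState ν) := by
  have h2 : ν ^ 2 < 1 := pow_lt_one₀ h0 h1 two_ne_zero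
  have hc : ∀ n : ℕ, 0 ≤ (1 - ν ^ 2) * ν ^ (2 * n) := fun n =>
    mul_nonneg (by linarith) (by positivity)
  refine ⟨?_, ?_⟩
  · rw [ContinuousLinearMap.isPositive_iff_complex]
    intro u
    have h3 : ⟪geometricState ν u, u⟫_ℂ
        = ((∑' n, (1 - ν ^ 2) * ν ^ (2 * n) * ‖u n‖ ^ 2 : ℝ) : ℂ) := by
      rw [lp.inner_eq_tsum, Complex.ofReal_tsum]
      refine tsum_congr fun n => ?_
      rw [geometricState_apply h0 h1, RCLike.inner_apply, map_mul, Complex.conj_ofReal,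
        mul_left_comm, Complex.mul_conj']
      push_cast
      ring
    rw [h3]
    exact ⟨rfl, tsum_nonneg fun n => mul_nonneg (hc n) (by positivity)⟩
  · have h3 : HasSum (fun n : ℕ => (1 - ν ^ 2) * (ν ^ 2) ^ n) 1 := by
      have := (hasSum_geometric_of_lt_one (sq_nonneg ν) h2).mul_left (1 - ν ^ 2)
      rwa [mul_inv_cancel₀ (by linarith)] at this
    have h4 := Complex.hasSum_ofReal.2 h3
    rw [Complex.ofReal_one] at h4
    refine h4.congr_fun fun n => ?_
    rw [inner_e, geometricState_apply h0 h1, e_apply, if_pos rfl, mul_one, pow_mul]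

lemma trace_geometricState_comp (y : Fock →L[ℂ] Fock) : trace (geometricState ν ∘L y)
    = (1 - (ν : ℂ) ^ 2) * ∑' n, ((ν ^ (2 * n) : ℝ) : ℂ) * ⟪e n, y (e n)⟫_ℂ := by
  rw [trace, ← tsum_mul_left]
  refine tsum_congr fun n => ?_
  rw [ContinuousLinearMap.comp_apply, inner_e, inner_e, geometricState_apply h0 h1]
  push_cast
  ring

end GeometricState

end QuadraticOscillator

end

theorem proposition3 (r lam mu ζp ζm : ℝ) (hr : 0 < r) (hlam : 0 < lam) (hmu : 0 < mu)
    (hν : lam / mu < 1) :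
    QuadraticOscillator.IsInvariantState
      (QuadraticOscillator.semigroup r lam mu ζp ζm)
      (QuadraticOscillator.geometricState (lam / mu)) := by
  have h0 : 0 ≤ lam / mu := by positivity
  refine ⟨QuadraticOscillator.isDensityOperator_geometricState h0 hν, fun t ht x => ?_⟩
  rw [QuadraticOscillator.trace_geometricState_comp h0 hν,
    QuadraticOscillator.trace_geometricState_comp h0 hν,
    QuadraticOscillator.tsum_diag_semigroup hr hlam hmu hν ζp ζm x ht]
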